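/- Let $X$ be a real random variable with $\operatorname{Var} X = 1$ and characteristic function $f(t)=\mathbb{E}\,e^{itX}$, let $X_1,X_2,\dots$ be independent copies of $X$, and put $Z_k = (X_1+\dots+X_k)/\sqrt{k}$ for $k\ge 1$. Suppose that for some integer $n_0\ge 1$ the random variable $Z_{n_0}$ has a density with respect to Lebesgue measure on $\mathbb{R}$ that is bounded by a constant $M$. Then for all $0<\varepsilon\le 1$ and all integers $n\ge 4n_0$, the function $|f|^n$ is integrable on $\{|t|\ge\varepsilon\}$ and $$\int_{|t|\ge\varepsilon}|f(t)|^n\,dt\;\le\;\frac{4\pi M}{\sqrt{2n}}\,\exp\Big\{-\frac{n\varepsilon^2}{C\,n_0M^2}\Big\},\qquad C=5200.$$ -/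

import Mathlib

open MeasureTheory ProbabilityTheory

/-- The normalized sum `Z_n = (X_1 + ⋯ + X_n) / √n` of a sequence of real random variables,
indexed from `0`. -/
noncomputable def normalizedSum {Ω : Type*} (Xs : ℕ → Ω → ℝ) (n : ℕ) (ω : Ω) : ℝ :=
  (∑ i ∈ Finset.range n, Xs i ω) / √(n : ℝ)

/-- The real random variable `Z` has, under `P`, a density (with respect to Lebesgue measure)
that is bounded by `M` everywhere. -/
def HasDensityBoundedBy {Ω : Type*} [MeasurableSpace Ω] (P : Measure Ω) (Z : Ω → ℝ) (M : ℝ) :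
    Prop :=
  ∃ p : ℝ → ℝ, Measurable p ∧ (∀ x, 0 ≤ p x) ∧ (∀ x, p x ≤ M) ∧
    P.map Z = volume.withDensity (fun x => ENNReal.ofReal (p x))

/-!
Let `μ ≤ M • volume` be a probability measure with characteristic function `f`. Everything rests on
the sharp moment bound `∫ ‖f‖ ^ (2 k) ≤ 2 M ∫ sinc ^ (2 k)`, with equality for the uniform law on
an interval of length `1 / M`. Stratified sampling of the quantile function replaces `μ` by the
uniform measure on `N` points with gaps at least `1 / (N M)`. Expanding the `2 k`-th power of its
exponential sum gives the alternating sums of `2 k` sample points, and a symmetric chain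
decomposition arranges these into separated chains. The integral of the exponential sum of a chain
against `e ^ (-b t²)` is a sum of values of a Gaussian of mass `2 π` at separated points, hence at
most `2 π N M + O(1)` as `N → ∞`. The number of chains does not depend on the sample: it is the
zero-weight multiplicity in the `2 k`-th tensor power of the `N`-dimensional representation of
`SU(2)`, that is, the constant term of `(sin (N x) / sin x) ^ (2 k)`, and after rescaling it
converges to `∫ sinc ^ (2 k)`. Letting `N → ∞` and then `b → 0` gives the bound.

Hölder's inequality extends it to noninteger exponents. Away from the origin `‖f‖` is bounded
pointwise: `1 - ‖f u‖` is the `μ`-integral of `1 - cos (u x - φ)`, and a law with density at most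
`M`, most of whose mass lies in a bounded interval by Chebyshev's inequality, cannot concentrate
near the zeros of this function. The tail integral then follows by splitting
`‖f‖ ^ s = ‖f‖ ^ (s - 2 j) ‖f‖ ^ (2 j)`, applied to the law of `Z_{n₀}` with `s = n / n₀`.
-/

open Filter Topology

section Chains

/-- The exponential sum `∑ e^{itx}` over the entries `x` of a list of frequencies. -/
noncomputable def expSum (c : List ℝ) (t : ℝ) : ℂ :=
  (c.map fun x : ℝ => Complex.exp (t * x * Complex.I)).sum

/-- A `δ`-separated list: an increasing list whose entries differ by at least `δ`. -/
def IsSeparated (δ : ℝ) (c : List ℝ) : Prop :=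
  c.Pairwise fun x y => x + δ ≤ y

/-- The character `sin (ℓ x) / sin x` of the `ℓ`-dimensional irreducible representation of `SU(2)`,
written with a Chebyshev polynomial in order to be continuous at the zeros of `sin`. -/
noncomputable def su2Character (ℓ : ℕ) (x : ℝ) : ℝ :=
  (Polynomial.Chebyshev.U ℝ (ℓ - 1)).eval (Real.cos x)

/-- The symmetric chain decomposition of the differences `a - b` of the entries of two lists: the
first chain is `a₁ - bₙ, …, a₁ - b₁, a₂ - b₁, …, aₘ - b₁`, and one recurses on the tails. -/
def differenceChains : List ℝ → List ℝ → List (List ℝ)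
  | a :: as, b :: bs =>
    ((bs.map (a - ·)).reverse ++ (a :: as).map (· - b)) :: differenceChains as bs
  | _, _ => []

/-- The `m`-fold alternating sums `a₁ - (a₂ - (a₃ - ⋯))` of entries of a list, decomposed into
chains. -/
def iteratedDifferenceChains (c : List ℝ) : ℕ → List (List ℝ)
  | 0 => [[0]]
  | m + 1 => (iteratedDifferenceChains c m).flatMap (differenceChains c)

theorem expSum_nil (t : ℝ) : expSum [] t = 0 := rfl

theorem expSum_cons (x : ℝ) (c : List ℝ) (t : ℝ) :
    expSum (x :: c) t = Complex.exp (t * x * Complex.I) + expSum c t :=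
  List.sum_cons

theorem expSum_append (c d : List ℝ) (t : ℝ) : expSum (c ++ d) t = expSum c t + expSum d t := by
  simp only [expSum, List.map_append, List.sum_append]

theorem expSum_map_sub_const (c : List ℝ) (b t : ℝ) :
    expSum (c.map (· - b)) t =
      expSum c t * (starRingEnd ℂ) (Complex.exp (t * b * Complex.I)) := by
  rw [expSum, expSum, List.map_map, ← List.sum_map_mul_right]
  refine congrArg List.sum (List.map_congr_left fun x _ => ?_)
  rw [Function.comp_apply, ← Complex.exp_conj, ← Complex.exp_add]
  congr 1
  simp only [Complex.ofReal_sub, map_mul, Complex.conj_ofReal, Complex.conj_I]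
  ring

theorem expSum_reverse_map_const_sub (c : List ℝ) (a t : ℝ) :
    expSum (c.map (a - ·)).reverse t =
      Complex.exp (t * a * Complex.I) * (starRingEnd ℂ) (expSum c t) := by
  rw [expSum, expSum, List.map_reverse, List.sum_reverse, List.map_map, map_list_sum,
    List.map_map, ← List.sum_map_mul_left]
  refine congrArg List.sum (List.map_congr_left fun x _ => ?_)
  simp only [Function.comp_apply]
  rw [← Complex.exp_conj, ← Complex.exp_add]
  congr 1
  simp only [Complex.ofReal_sub, map_mul, Complex.conj_ofReal, Complex.conj_I]
  ring

theorem sum_expSum_differenceChains (c d : List ℝ) (t : ℝ) :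
    ((differenceChains c d).map (expSum · t)).sum = expSum c t * (starRingEnd ℂ) (expSum d t) := by
  induction c generalizing d with
  | nil => simp [differenceChains, expSum_nil]
  | cons a as ih =>
    cases d with
    | nil => simp [differenceChains, expSum_nil]
    | cons b bs =>
      rw [differenceChains, List.map_cons, List.sum_cons, ih, expSum_append,
        expSum_reverse_map_const_sub, expSum_map_sub_const, expSum_cons, expSum_cons, map_add]
      ring

theorem su2Character_zero (x : ℝ) : su2Character 0 x = 0 := by
  simp [su2Character]

theorem su2Character_one (x : ℝ) : su2Character 1 x = 1 := by
  simp [su2Character]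

theorem su2Character_mul_sin (ℓ : ℕ) (x : ℝ) :
    su2Character ℓ x * Real.sin x = Real.sin (ℓ * x) := by
  rw [su2Character, Polynomial.Chebyshev.U_real_cos]
  push_cast
  ring_nf

theorem continuous_su2Character (ℓ : ℕ) : Continuous (su2Character ℓ) :=
  (Polynomial.continuous _).comp Real.continuous_cos

theorem su2Character_add_two (ℓ : ℕ) (x : ℝ) :
    su2Character (ℓ + 2) x = 2 * Real.cos x * su2Character (ℓ + 1) x - su2Character ℓ x := by
  have hU := congrArg (Polynomial.eval (Real.cos x)) (Polynomial.Chebyshev.U_add_two ℝ (ℓ - 1))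
  simp only [Polynomial.eval_sub, Polynomial.eval_mul, Polynomial.eval_X,
    Polynomial.eval_ofNat] at hU
  simp only [su2Character, Nat.cast_add, Nat.cast_ofNat, Nat.cast_one]
  rwa [show (ℓ : ℤ) + 2 - 1 = ℓ - 1 + 2 by ring, show (ℓ : ℤ) + 1 - 1 = ℓ - 1 + 1 by ring]

theorem su2Character_succ_mul_succ (a b : ℕ) (x : ℝ) :
    su2Character (a + 1) x * su2Character (b + 1) x =
      su2Character (a + b + 1) x + su2Character a x * su2Character b x := by
  induction a generalizing b with
  | zero => simp [su2Character_zero, su2Character_one]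
  | succ a ih =>
    have h := ih (b + 1)
    rw [su2Character_add_two b, show a + (b + 1) + 1 = a + 1 + b + 1 by ring] at h
    rw [su2Character_add_two a]
    linear_combination h

theorem sum_su2Character_differenceChains (c d : List ℝ) (x : ℝ) :
    ((differenceChains c d).map fun e => su2Character e.length x).sum =
      su2Character c.length x * su2Character d.length x := by
  induction c generalizing d with
  | nil => simp [differenceChains, su2Character_zero]
  | cons a as ih =>
    cases d with
    | nil => simp [differenceChains, su2Character_zero]
    | cons b bs =>
      rw [differenceChains, List.map_cons, List.sum_cons, ih, List.length_cons, List.length_cons,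
        su2Character_succ_mul_succ]
      simp only [List.length_append, List.length_reverse, List.length_map, List.length_cons]
      congr 2
      ring

theorem length_mod_two_of_mem_differenceChains {c d e : List ℝ} (he : e ∈ differenceChains c d) :
    e.length % 2 = (c.length + d.length + 1) % 2 := by
  induction c generalizing d with
  | nil => simp [differenceChains] at he
  | cons a as ih =>
    cases d with
    | nil => simp [differenceChains] at he
    | cons b bs =>
      rw [differenceChains, List.mem_cons] at he
      rcases he with rfl | he
      · simp only [List.length_append, List.length_reverse, List.length_map, List.length_cons]
        omega
      · have := ih he
        simp only [List.length_cons]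
        omega

theorem IsSeparated.of_mem_differenceChains {δ : ℝ} (hδ : 0 ≤ δ) {c d e : List ℝ}
    (hc : IsSeparated δ c) (hd : IsSeparated δ d) (he : e ∈ differenceChains c d) :
    IsSeparated δ e := by
  induction c generalizing d with
  | nil => simp [differenceChains] at he
  | cons a as ih =>
    cases d with
    | nil => simp [differenceChains] at he
    | cons b bs =>
      have hc' := List.pairwise_cons.1 hc
      have hd' := List.pairwise_cons.1 hd
      rw [differenceChains, List.mem_cons] at he
      rcases he with rfl | he
      · refine List.pairwise_append.2 ⟨?_, ?_, ?_⟩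
        · refine List.pairwise_reverse.2 (hd'.2.map _ fun x y hxy => ?_)
          linarith
        · exact hc.map _ fun x y hxy => by linarith
        · intro x hx y hy
          simp only [List.mem_reverse, List.mem_map, List.mem_cons] at hx hy
          obtain ⟨u, hu, rfl⟩ := hx
          obtain ⟨v, rfl | hv, rfl⟩ := hy
          · linarith [hd'.1 u hu]
          · linarith [hd'.1 u hu, hc'.1 v hv]
      · exact ih hc'.2 hd'.2 he

theorem IsSeparated.of_mem_iteratedDifferenceChains {δ : ℝ} (hδ : 0 ≤ δ) {c e : List ℝ}
    (hc : IsSeparated δ c) {m : ℕ} (he : e ∈ iteratedDifferenceChains c m) : IsSeparated δ e := by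
  induction m generalizing e with
  | zero => simp_all [iteratedDifferenceChains, IsSeparated]
  | succ m ih =>
    obtain ⟨d, hd, hed⟩ := List.mem_flatMap.1 he
    exact hc.of_mem_differenceChains hδ (ih hd) hed

theorem length_mod_two_of_mem_iteratedDifferenceChains {c e : List ℝ} {m : ℕ}
    (he : e ∈ iteratedDifferenceChains c m) : e.length % 2 = (m * (c.length + 1) + 1) % 2 := by
  induction m generalizing e with
  | zero => simp_all [iteratedDifferenceChains]
  | succ m ih =>
    obtain ⟨d, hd, hed⟩ := List.mem_flatMap.1 he
    rw [length_mod_two_of_mem_differenceChains hed, add_mul]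
    have := ih hd
    omega

theorem sum_map_flatMap {α β R : Type*} [AddMonoid R] (l : List α) (g : α → List β)
    (f : β → R) : ((l.flatMap g).map f).sum = (l.map fun a => ((g a).map f).sum).sum := by
  induction l with
  | nil => simp
  | cons a l ih => simp [List.flatMap_cons, ih]

theorem sum_su2Character_iteratedDifferenceChains (c : List ℝ) (m : ℕ) (x : ℝ) :
    ((iteratedDifferenceChains c m).map fun e => su2Character e.length x).sum =
      su2Character c.length x ^ m := by
  induction m with
  | zero => simp [iteratedDifferenceChains, su2Character_one]
  | succ m ih =>
    rw [iteratedDifferenceChains, sum_map_flatMap]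
    simp only [sum_su2Character_differenceChains]
    rw [List.sum_map_mul_left, ih, pow_succ']

theorem sum_expSum_iteratedDifferenceChains (c : List ℝ) (k : ℕ) (t : ℝ) :
    ((iteratedDifferenceChains c (2 * k)).map (expSum · t)).sum = ‖expSum c t‖ ^ (2 * k) := by
  have hstep (m : ℕ) : ((iteratedDifferenceChains c (m + 1)).map (expSum · t)).sum =
      expSum c t *
        (starRingEnd ℂ) ((iteratedDifferenceChains c m).map (expSum · t)).sum := by
    rw [iteratedDifferenceChains, sum_map_flatMap, map_list_sum, List.map_map,
      ← List.sum_map_mul_left]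
    simp only [sum_expSum_differenceChains, Function.comp_def]
  induction k with
  | zero => simp [iteratedDifferenceChains, expSum]
  | succ k ih =>
    rw [show 2 * (k + 1) = 2 * k + 1 + 1 by ring, hstep, hstep, ih, map_mul, Complex.conj_conj,
      ← mul_assoc, Complex.mul_conj, Complex.normSq_eq_norm_sq]
    push_cast
    ring

theorem su2Character_add_two_eq_add_cos (ℓ : ℕ) (x : ℝ) :
    su2Character (ℓ + 2) x = su2Character ℓ x + 2 * Real.cos ((ℓ + 1 : ℕ) * x) := by
  have hU := congrArg (Polynomial.eval (Real.cos x))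
    (Polynomial.Chebyshev.U_eq_two_mul_T_add_U ℝ (ℓ - 1))
  simp only [Polynomial.eval_add, Polynomial.eval_mul, Polynomial.eval_ofNat,
    Polynomial.Chebyshev.T_real_cos] at hU
  simp only [su2Character, Nat.cast_add, Nat.cast_ofNat, Nat.cast_one]
  rw [show (ℓ : ℤ) + 2 - 1 = ℓ - 1 + 2 by ring, hU]
  push_cast
  ring_nf

theorem integral_su2Character_odd (m : ℕ) :
    ∫ x in (0 : ℝ)..Real.pi, su2Character (2 * m + 1) x = Real.pi := by
  induction m with
  | zero => simp [su2Character_one]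
  | succ m ih =>
    simp only [show 2 * (m + 1) + 1 = 2 * m + 1 + 2 by ring, su2Character_add_two_eq_add_cos]
    rw [intervalIntegral.integral_add ((continuous_su2Character _).intervalIntegrable _ _)
        (by apply Continuous.intervalIntegrable; fun_prop), ih,
      intervalIntegral.integral_const_mul,
      intervalIntegral.integral_comp_mul_left Real.cos (by positivity)]
    simp only [integral_cos, mul_zero, Real.sin_zero, sub_zero, Real.sin_nat_mul_pi, smul_zero,
      add_zero]

theorem integral_sum_su2Character {C : List (List ℝ)} (hC : ∀ c ∈ C, c.length % 2 = 1) :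
    ∫ x in (0 : ℝ)..Real.pi, (C.map fun c => su2Character c.length x).sum =
      C.length * Real.pi := by
  induction C with
  | nil => simp
  | cons c C ih =>
    have hcont : Continuous fun x => (C.map fun c => su2Character c.length x).sum :=
      continuous_list_sum _ fun c _ => continuous_su2Character c.length
    have hc : c.length = 2 * (c.length / 2) + 1 := by
      have := hC c List.mem_cons_self
      omega
    simp only [List.map_cons, List.sum_cons, List.length_cons]
    rw [intervalIntegral.integral_add ((continuous_su2Character _).intervalIntegrable _ _)
        (hcont.intervalIntegrable _ _), ih fun d hd => hC d (List.mem_cons_of_mem _ hd), hc,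
      integral_su2Character_odd]
    push_cast
    ring

/-- Each chain of odd length contributes `π` to the integral of its character. -/
theorem length_iteratedDifferenceChains (c : List ℝ) (k : ℕ) :
    ((iteratedDifferenceChains c (2 * k)).length : ℝ) =
      (∫ x in (0 : ℝ)..Real.pi, su2Character c.length x ^ (2 * k)) / Real.pi := by
  have hodd : ∀ e ∈ iteratedDifferenceChains c (2 * k), e.length % 2 = 1 := fun e he => by
    rw [length_mod_two_of_mem_iteratedDifferenceChains he, mul_assoc]
    omega
  rw [eq_div_iff Real.pi_ne_zero, ← integral_sum_su2Character hodd]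
  simp only [sum_su2Character_iteratedDifferenceChains]

section UnimodalSum

variable {f : ℝ → ℝ} {δ : ℝ} {c : List ℝ}

theorem IsSeparated.sum_map_le_integral_Ioi (hc : IsSeparated δ c) (hδ : 0 ≤ δ) (hf0 : 0 ≤ f)
    (hf : Integrable f) (hanti : AntitoneOn f (Set.Ici 0)) {a : ℝ} (ha : 0 ≤ a)
    (hac : ∀ x ∈ c, a + δ ≤ x) : δ * (c.map f).sum ≤ ∫ x in Set.Ioi a, f x := by
  induction c generalizing a with
  | nil => simpa using integral_nonneg hf0
  | cons x c ih =>
    have hc' := List.pairwise_cons.1 hc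
    have hax : a + δ ≤ x := hac x List.mem_cons_self
    have hhead : δ * f x ≤ ∫ y in Set.Ioc a x, f y :=
      calc δ * f x ≤ f x * (x - a) := by rw [mul_comm]; gcongr; exacts [hf0 x, by linarith]
        _ = f x * volume.real (Set.Ioc a x) := by rw [Real.volume_real_Ioc_of_le (by linarith)]
        _ ≤ ∫ y in Set.Ioc a x, f y :=
          setIntegral_ge_of_const_le_real measurableSet_Ioc (by simp)
            (fun y hy => hanti (ha.trans hy.1.le) (ha.trans (by linarith)) hy.2) hf.integrableOn
    have htail := ih hc'.2 (a := x) (by linarith) hc'.1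
    rw [← Set.Ioc_union_Ioi_eq_Ioi (by linarith : a ≤ x), setIntegral_union
      (Set.Ioc_disjoint_Ioi le_rfl) measurableSet_Ioi hf.integrableOn hf.integrableOn,
      List.map_cons, List.sum_cons, mul_add]
    exact add_le_add hhead htail

theorem IsSeparated.sum_map_le_add_integral_Ioi (hc : IsSeparated δ c) (hδ : 0 ≤ δ) (hf0 : 0 ≤ f)
    (hf : Integrable f) (hanti : AntitoneOn f (Set.Ici 0)) (hnonneg : ∀ x ∈ c, 0 ≤ x) :
    δ * (c.map f).sum ≤ δ * f 0 + ∫ x in Set.Ioi 0, f x := by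
  cases c with
  | nil => simpa using add_nonneg (mul_nonneg hδ (hf0 0)) (integral_nonneg hf0)
  | cons x c =>
    have hc' := List.pairwise_cons.1 hc
    have hx := hnonneg x List.mem_cons_self
    rw [List.map_cons, List.sum_cons, mul_add]
    refine add_le_add (mul_le_mul_of_nonneg_left (hanti Set.self_mem_Ici hx hx) hδ)
      (IsSeparated.sum_map_le_integral_Ioi hc'.2 hδ hf0 hf hanti le_rfl fun y hy => ?_)
    linarith [hc'.1 y hy]

theorem IsSeparated.sum_map_le_two_mul_add_integral_Ioi (hc : IsSeparated δ c) (hδ : 0 ≤ δ)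
    (hf0 : 0 ≤ f) (hf : Integrable f) (hmono : MonotoneOn f (Set.Iic 0))
    (hanti : AntitoneOn f (Set.Ici 0)) {a : ℝ} (ha : a ≤ 0) (hac : ∀ x ∈ c, a ≤ x) :
    δ * (c.map f).sum ≤ 2 * (δ * f 0) + ∫ x in Set.Ioi a, f x := by
  have hfδ : 0 ≤ δ * f 0 := mul_nonneg hδ (hf0 0)
  induction c generalizing a with
  | nil => simpa using add_nonneg (by linarith) (integral_nonneg hf0)
  | cons x c ih =>
    have hsub {b : ℝ} (hab : a ≤ b) : ∫ y in Set.Ioi b, f y ≤ ∫ y in Set.Ioi a, f y :=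
      setIntegral_mono_set hf.integrableOn (ae_of_all _ hf0) (Set.Ioi_subset_Ioi hab).eventuallyLE
    have hax := hac x List.mem_cons_self
    have hc' := List.pairwise_cons.1 hc
    rcases le_total 0 x with hx | hx
    · have := hc.sum_map_le_add_integral_Ioi hδ hf0 hf hanti <| by
        rintro y (_ | ⟨_, hy⟩)
        exacts [hx, by linarith [hc'.1 y hy]]
      linarith [hsub ha]
    rw [List.map_cons, List.sum_cons, mul_add]
    rcases le_total 0 (x + δ) with hxδ | hxδ
    · have hhead := mul_le_mul_of_nonneg_left (hmono hx Set.self_mem_Iic hx) hδ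
      have htail := IsSeparated.sum_map_le_add_integral_Ioi hc'.2 hδ hf0 hf hanti
        fun y hy => hxδ.trans (hc'.1 y hy)
      linarith [hsub ha]
    · have hhead := setIntegral_ge_of_const_le_real measurableSet_Ioc (by simp)
        (fun y hy => hmono hx (hy.2.trans hxδ) hy.1.le) (hf.integrableOn (s := Set.Ioc x (x + δ)))
      rw [Real.volume_real_Ioc_of_le (by linarith), add_sub_cancel_left, mul_comm] at hhead
      have htail := ih hc'.2 hxδ hc'.1
      have hsplit := setIntegral_union (Set.Ioc_disjoint_Ioi le_rfl) measurableSet_Ioi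
        (hf.integrableOn (s := Set.Ioc x (x + δ))) (hf.integrableOn (s := Set.Ioi (x + δ)))
      rw [Set.Ioc_union_Ioi_eq_Ioi (by linarith)] at hsplit
      linarith [hsub hax]

theorem IsSeparated.sum_map_le_two_mul_add_integral (hc : IsSeparated δ c) (hδ : 0 ≤ δ)
    (hf0 : 0 ≤ f) (hf : Integrable f) (hmono : MonotoneOn f (Set.Iic 0))
    (hanti : AntitoneOn f (Set.Ici 0)) :
    δ * (c.map f).sum ≤ 2 * (δ * f 0) + ∫ x, f x := by
  obtain ⟨a, ha0, ha⟩ : ∃ a ≤ 0, ∀ x ∈ c, a ≤ x := by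
    cases c with
    | nil => exact ⟨0, le_rfl, by simp⟩
    | cons x c =>
      refine ⟨min x 0, min_le_right _ _, fun y hy => min_le_iff.2 (Or.inl ?_)⟩
      rcases List.mem_cons.1 hy with rfl | hy
      · exact le_rfl
      · linarith [(List.pairwise_cons.1 hc).1 y hy]
  exact (hc.sum_map_le_two_mul_add_integral_Ioi hδ hf0 hf hmono hanti ha0 ha).trans
    (add_le_add_right (setIntegral_le_integral hf (ae_of_all _ hf0)) _)

end UnimodalSum

theorem integrable_exp_mul_gaussian {b : ℝ} (hb : 0 < b) (x : ℝ) :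
    Integrable fun t : ℝ =>
      Complex.exp (t * x * Complex.I) * (Real.exp (-b * t ^ 2) : ℂ) := by
  refine (integrable_cexp_quadratic (b := b) (by simpa using hb) (Complex.I * x) 0).congr
    (ae_of_all _ fun t => ?_)
  simp only [Complex.ofReal_exp, ← Complex.exp_add]
  congr 1
  push_cast
  ring

theorem integral_exp_mul_gaussian {b : ℝ} (hb : 0 < b) (x : ℝ) :
    ∫ t : ℝ, Complex.exp (t * x * Complex.I) * (Real.exp (-b * t ^ 2) : ℂ) =
      (√(Real.pi / b) * Real.exp (-(1 / (4 * b)) * x ^ 2) : ℝ) := by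
  have hsqrt : ((Real.pi : ℂ) / b) ^ (1 / 2 : ℂ) = ((√(Real.pi / b) : ℝ) : ℂ) := by
    rw [Real.sqrt_eq_rpow, Complex.ofReal_cpow (by positivity)]
    push_cast
    rfl
  have h := fourierIntegral_gaussian (b := b) (by simpa using hb) x
  rw [hsqrt] at h
  convert h using 2
  · ext t
    push_cast
    ring_nf
  · push_cast
    ring_nf

theorem integrable_expSum_mul_gaussian {b : ℝ} (hb : 0 < b) (c : List ℝ) :
    Integrable fun t : ℝ => expSum c t * (Real.exp (-b * t ^ 2) : ℂ) := by
  induction c with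
  | nil => simp [expSum_nil]
  | cons x c ih =>
    simp only [expSum_cons, add_mul]
    exact (integrable_exp_mul_gaussian hb x).add ih

theorem integral_expSum_mul_gaussian {b : ℝ} (hb : 0 < b) (c : List ℝ) :
    ∫ t : ℝ, expSum c t * (Real.exp (-b * t ^ 2) : ℂ) =
      (√(Real.pi / b) * (c.map fun x => Real.exp (-(1 / (4 * b)) * x ^ 2)).sum : ℝ) := by
  induction c with
  | nil => simp [expSum_nil]
  | cons x c ih =>
    simp only [expSum_cons, add_mul, List.map_cons, List.sum_cons]
    rw [integral_add (integrable_exp_mul_gaussian hb x) (integrable_expSum_mul_gaussian hb c), ih,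
      integral_exp_mul_gaussian hb]
    push_cast
    ring

theorem IsSeparated.sum_gaussian_le {δ : ℝ} {c : List ℝ} (hc : IsSeparated δ c) (hδ : 0 < δ)
    {a : ℝ} (ha : 0 < a) :
    (c.map fun x => Real.exp (-a * x ^ 2)).sum ≤ 2 + √(Real.pi / a) / δ := by
  have hsum := hc.sum_map_le_two_mul_add_integral hδ.le (f := fun x => Real.exp (-a * x ^ 2))
    (fun x => (Real.exp_pos _).le) (integrable_exp_neg_mul_sq ha)
    (fun x _ y hy hxy => Real.exp_le_exp.2 <| by
      simp only [Set.mem_Iic] at hy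
      nlinarith [mul_nonneg ha.le (mul_nonneg (sub_nonneg.2 hxy) (by linarith : 0 ≤ -x - y))])
    (fun x hx y _ hxy => Real.exp_le_exp.2 <| by
      simp only [Set.mem_Ici] at hx
      nlinarith [mul_nonneg ha.le (mul_nonneg (sub_nonneg.2 hxy) (by linarith : 0 ≤ x + y))])
  rw [integral_gaussian] at hsum
  rw [← mul_le_mul_iff_right₀ hδ, mul_add, mul_div_cancel₀ _ hδ.ne']
  simpa [mul_comm] using hsum

theorem integral_norm_expSum_pow_mul_gaussian_le {δ : ℝ} {c : List ℝ} (hc : IsSeparated δ c)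
    (hδ : 0 < δ) {b : ℝ} (hb : 0 < b) (k : ℕ) :
    ∫ t : ℝ, ‖expSum c t‖ ^ (2 * k) * Real.exp (-b * t ^ 2) ≤
      (∫ y in (0 : ℝ)..Real.pi, su2Character c.length y ^ (2 * k)) / Real.pi *
        (2 * √(Real.pi / b) + 2 * Real.pi / δ) := by
  set C := iteratedDifferenceChains c (2 * k)
  set g : ℝ → ℝ := fun x => Real.exp (-(1 / (4 * b)) * x ^ 2)
  have hexp (t : ℝ) : ((‖expSum c t‖ ^ (2 * k) : ℝ) : ℂ) = expSum C.flatten t := by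
    rw [Complex.ofReal_pow, ← sum_expSum_iteratedDifferenceChains, expSum, List.map_flatten,
      List.sum_flatten, List.map_map]
    rfl
  have hchains : (C.flatten.map g).sum ≤ C.length * (2 + √(Real.pi / (1 / (4 * b))) / δ) := by
    rw [List.map_flatten, List.sum_flatten, List.map_map, ← nsmul_eq_mul,
      ← List.length_map (List.sum ∘ List.map g)]
    refine List.sum_le_card_nsmul _ _ fun s hs => ?_
    obtain ⟨e, he, rfl⟩ := List.mem_map.1 hs
    exact (hc.of_mem_iteratedDifferenceChains hδ.le he).sum_gaussian_le hδ (by positivity)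
  have hsqrt : √(Real.pi / b) * √(Real.pi / (1 / (4 * b))) = 2 * Real.pi := by
    rw [← Real.sqrt_mul (by positivity), ← Real.sqrt_sq (by positivity : 0 ≤ 2 * Real.pi)]
    congr 1
    field_simp
    ring
  have hint : ∫ t : ℝ, ‖expSum c t‖ ^ (2 * k) * Real.exp (-b * t ^ 2) =
      √(Real.pi / b) * (C.flatten.map g).sum := by
    rw [← Complex.ofReal_inj, ← integral_expSum_mul_gaussian hb, ← integral_complex_ofReal]
    simp only [Complex.ofReal_mul, hexp]
  rw [hint, ← length_iteratedDifferenceChains]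
  calc √(Real.pi / b) * (C.flatten.map g).sum
      ≤ √(Real.pi / b) * (C.length * (2 + √(Real.pi / (1 / (4 * b))) / δ)) := by gcongr
    _ = C.length * (2 * √(Real.pi / b) +
          √(Real.pi / b) * √(Real.pi / (1 / (4 * b))) / δ) := by ring
    _ = C.length * (2 * √(Real.pi / b) + 2 * Real.pi / δ) := by rw [hsqrt]

end Chains

section QuantileSample

theorem pos_of_le_ofReal_smul_volume {μ : Measure ℝ} [NeZero μ] {M : ℝ}
    (hμ : μ ≤ ENNReal.ofReal M • volume) : 0 < M := by
  by_contra hM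
  rw [ENNReal.ofReal_of_nonpos (not_lt.1 hM), zero_smul] at hμ
  exact NeZero.ne μ (le_bot_iff.1 hμ)

theorem exists_measurable_rightInvOn_cdf {μ : Measure ℝ} (hcont : Continuous (cdf μ)) :
    ∃ q : ℝ → ℝ, Measurable q ∧ Set.RightInvOn q (cdf μ) (Set.Ioo 0 1) := by
  have hsurj (u : ℝ) (hu : u ∈ Set.Ioo (0 : ℝ) 1) : ∃ a, cdf μ a = u :=
    mem_range_of_exists_le_of_exists_ge hcont
      ((tendsto_cdf_atBot μ).eventually_le_const hu.1).exists
      ((tendsto_cdf_atTop μ).eventually_const_le hu.2).exists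
  choose! q₀ hq₀ using hsurj
  have hmono : MonotoneOn q₀ (Set.Ioo 0 1) :=
    Function.monotoneOn_of_rightInvOn_of_mapsTo ((monotone_cdf μ).monotoneOn _) hq₀
      (Set.mapsTo_univ _ _)
  refine ⟨(Set.Ioo 0 1).indicator q₀, ?_, fun u hu => ?_⟩
  · refine measurable_of_restrict_of_restrict_compl (s := Set.Ioo 0 1) measurableSet_Ioo ?_ ?_
    · exact Monotone.measurable fun u v huv => by
        simpa using hmono u.2 v.2 huv
    · rw [show Set.domRestrict (Set.Ioo 0 1)ᶜ ((Set.Ioo 0 1).indicator q₀) = 0 from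
        funext fun u => Set.indicator_of_notMem u.2 q₀]
      exact measurable_const
  · rw [Set.indicator_of_mem hu, hq₀ u hu]

variable {μ : Measure ℝ} [IsProbabilityMeasure μ] {M : ℝ}

theorem cdf_sub_cdf_le (hμ : μ ≤ ENNReal.ofReal M • volume) {a b : ℝ} (hab : a ≤ b) :
    cdf μ b - cdf μ a ≤ M * (b - a) := by
  have hM := pos_of_le_ofReal_smul_volume hμ
  have hIoc : μ.real (Set.Ioc a b) = cdf μ b - cdf μ a := by
    rw [cdf_eq_real, cdf_eq_real, ← Set.Iic_sdiff_Iic, measureReal_sdiff (Set.Iic_subset_Iic.2 hab)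
      measurableSet_Iic]
  have h := hμ (Set.Ioc a b)
  rw [Measure.smul_apply, Real.volume_Ioc, smul_eq_mul, ← ENNReal.ofReal_mul hM.le] at h
  rw [← hIoc]
  exact ENNReal.toReal_le_of_le_ofReal (mul_nonneg hM.le (by linarith)) h

theorem continuous_cdf (hμ : μ ≤ ENNReal.ofReal M • volume) : Continuous (cdf μ) := by
  have hM := pos_of_le_ofReal_smul_volume hμ
  refine (LipschitzWith.of_le_add_mul M.toNNReal fun x y => ?_).continuous
  rw [Real.coe_toNNReal _ hM.le, Real.dist_eq]
  rcases le_total x y with hxy | hyx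
  · linarith [monotone_cdf μ hxy, mul_nonneg hM.le (abs_nonneg (x - y))]
  · rw [abs_of_nonneg (by linarith)]
    linarith [cdf_sub_cdf_le hμ hyx]

theorem map_restrict_Ioo_of_rightInvOn_cdf {q : ℝ → ℝ} (hq : Measurable q)
    (hinv : Set.RightInvOn q (cdf μ) (Set.Ioo 0 1)) :
    (volume.restrict (Set.Ioo 0 1)).map q = μ := by
  have : IsProbabilityMeasure (volume.restrict (Set.Ioo (0 : ℝ) 1)) := ⟨by simp⟩
  have := Measure.isProbabilityMeasure_map (μ := volume.restrict (Set.Ioo (0 : ℝ) 1))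
    hq.aemeasurable
  refine Measure.eq_of_cdf _ _ (StieltjesFunction.ext fun x => ?_)
  have hsub : q ⁻¹' Set.Iic x ∩ Set.Ioo 0 1 ⊆ Set.Ioc 0 (cdf μ x) := fun u hu =>
    ⟨hu.2.1, (hinv hu.2).symm.trans_le (monotone_cdf μ hu.1)⟩
  have hsup : Set.Ioo 0 (cdf μ x) ⊆ q ⁻¹' Set.Iic x ∩ Set.Ioo 0 1 := fun u hu => by
    have hu' : u ∈ Set.Ioo (0 : ℝ) 1 := ⟨hu.1, hu.2.trans_le (cdf_le_one μ x)⟩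
    refine ⟨show q u ≤ x from le_of_not_gt fun hx => ?_, hu'⟩
    have := monotone_cdf μ hx.le
    rw [hinv hu'] at this
    exact hu.2.not_ge this
  have hvol : volume (q ⁻¹' Set.Iic x ∩ Set.Ioo 0 1) = ENNReal.ofReal (cdf μ x) :=
    le_antisymm ((measure_mono hsub).trans (by simp)) (le_trans (by simp) (measure_mono hsup))
  rw [cdf_eq_real, measureReal_def, Measure.map_apply hq measurableSet_Iic,
    Measure.restrict_apply (hq measurableSet_Iic), hvol, ENNReal.toReal_ofReal (cdf_nonneg μ x)]

/-- The sample of the quantile function `q` at the `N` levels `(v + i) / N`. For `v` uniform in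
`(0, 1)` it is a stratified sample of the law with quantile function `q`. -/
noncomputable def quantileSample (q : ℝ → ℝ) (N : ℕ) (v : ℝ) : List ℝ :=
  (List.range N).map fun i : ℕ => q ((v + i) / N)

theorem length_quantileSample (q : ℝ → ℝ) (N : ℕ) (v : ℝ) : (quantileSample q N v).length = N := by
  rw [quantileSample, List.length_map, List.length_range]

theorem expSum_quantileSample (q : ℝ → ℝ) (N : ℕ) (v t : ℝ) :
    expSum (quantileSample q N v) t =
      ∑ i ∈ Finset.range N, Complex.exp (t * q ((v + i) / N) * Complex.I) := by
  rw [expSum, quantileSample, List.map_map]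
  rfl

theorem measurable_expSum_quantileSample {q : ℝ → ℝ} (hq : Measurable q) (N : ℕ) :
    Measurable fun p : ℝ × ℝ => expSum (quantileSample q N p.1) p.2 := by
  simp only [expSum_quantileSample]
  fun_prop

theorem norm_expSum_quantileSample_le (q : ℝ → ℝ) (N : ℕ) (v t : ℝ) :
    ‖expSum (quantileSample q N v) t‖ ≤ N := by
  rw [expSum_quantileSample]
  refine (norm_sum_le_of_le (Finset.range N) fun i _ => ?_).trans
    (by simp : ∑ _i ∈ Finset.range N, (1 : ℝ) ≤ N)
  rw [← Complex.ofReal_mul, Complex.norm_exp_ofReal_mul_I]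

theorem isSeparated_quantileSample (hμ : μ ≤ ENNReal.ofReal M • volume) {q : ℝ → ℝ}
    (hinv : Set.RightInvOn q (cdf μ) (Set.Ioo 0 1)) {v : ℝ} (hv : v ∈ Set.Ioo (0 : ℝ) 1) (N : ℕ) :
    IsSeparated (1 / (N * M)) (quantileSample q N v) := by
  have hM := pos_of_le_ofReal_smul_volume hμ
  have hmono : MonotoneOn q (Set.Ioo 0 1) :=
    Function.monotoneOn_of_rightInvOn_of_mapsTo ((monotone_cdf μ).monotoneOn _) hinv
      (Set.mapsTo_univ _ _)
  refine List.pairwise_map.2 (List.pairwise_lt_range.imp_of_mem fun {i j} hi hj hij => ?_)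
  have hN : (0 : ℝ) < N := by
    exact_mod_cast (Nat.zero_le i).trans_lt (List.mem_range.1 hi)
  have hlevel {i : ℕ} (hi : i ∈ List.range N) : (v + i) / N ∈ Set.Ioo (0 : ℝ) 1 := by
    have : (i : ℝ) + 1 ≤ N := by exact_mod_cast List.mem_range.1 hi
    exact ⟨div_pos (by linarith [hv.1, i.cast_nonneg (α := ℝ)]) hN,
      (div_lt_one hN).2 (by linarith [hv.2])⟩
  have hij' : (i : ℝ) + 1 ≤ j := by exact_mod_cast hij
  have hgap := cdf_sub_cdf_le hμ
    (hmono (hlevel hi) (hlevel hj) (div_le_div_of_nonneg_right (by linarith) hN.le))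
  rw [hinv (hlevel hi), hinv (hlevel hj), ← sub_div] at hgap
  have : 1 / (N * M) ≤ q ((v + j) / N) - q ((v + i) / N) := by
    rw [← div_div, div_le_iff₀ hM, mul_comm]
    exact (div_le_div_of_nonneg_right (by linarith) hN.le).trans hgap
  linarith

theorem integral_sum_shifts_eq {E : Type*} [NormedAddCommGroup E] [NormedSpace ℝ E] {h : ℝ → E}
    (hh : IntervalIntegrable h volume 0 1) {N : ℕ} (hN : N ≠ 0) :
    ∫ v in (0 : ℝ)..1, ∑ i ∈ Finset.range N, h ((v + i) / N) =
      (N : ℝ) • ∫ u in (0 : ℝ)..1, h u := by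
  have hN' : (N : ℝ) ≠ 0 := Nat.cast_ne_zero.2 hN
  have hsub (i : ℕ) (hi : i < N) :
      IntervalIntegrable h volume ((i : ℝ) / N) (((i + 1 : ℕ) : ℝ) / N) := by
    refine hh.mono_set ?_
    rw [Set.uIcc_of_le zero_le_one, Set.uIcc_of_le (by gcongr; simp)]
    refine Set.Icc_subset_Icc (by positivity) ((div_le_one (by positivity)).2 ?_)
    exact_mod_cast hi
  have hcomp (i : ℕ) (hi : i < N) :
      IntervalIntegrable (fun v => h ((v + i) / N)) volume 0 1 := by
    have h₁ := ((hsub i hi).comp_mul_right (c := (N : ℝ)⁻¹)).comp_add_right (i : ℝ)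
    simpa [div_eq_mul_inv, hN'] using h₁
  rw [intervalIntegral.integral_finsetSum fun i hi => hcomp i (Finset.mem_range.1 hi)]
  have hadj := intervalIntegral.sum_integral_adjacent_intervals (f := h) (μ := volume)
    (a := fun i : ℕ => (i : ℝ) / N) (n := N) hsub
  rw [Nat.cast_zero, zero_div, div_self hN'] at hadj
  rw [← hadj, Finset.smul_sum]
  refine Finset.sum_congr rfl fun i _ => ?_
  simp only [add_div, intervalIntegral.integral_comp_div_add _ hN']
  rw [zero_div, zero_add, Nat.cast_succ, add_div, add_comm (1 / (N : ℝ))]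

theorem integral_expSum_quantileSample {q : ℝ → ℝ} (hq : Measurable q)
    (hinv : Set.RightInvOn q (cdf μ) (Set.Ioo 0 1)) {N : ℕ} (hN : N ≠ 0) (t : ℝ) :
    ∫ v in Set.Ioo 0 1, expSum (quantileSample q N v) t = N * charFun μ t := by
  have hint : IntervalIntegrable (fun u => Complex.exp (t * q u * Complex.I)) volume 0 1 := by
    rw [intervalIntegrable_iff_integrableOn_Ioc_of_le zero_le_one]
    refine Measure.integrableOn_of_bounded (M := 1) (by simp) (by fun_prop)
      (ae_of_all _ fun u => ?_)
    rw [← Complex.ofReal_mul, Complex.norm_exp_ofReal_mul_I]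
  have hshift := integral_sum_shifts_eq hint hN
  rw [intervalIntegral.integral_of_le zero_le_one, intervalIntegral.integral_of_le zero_le_one,
    integral_Ioc_eq_integral_Ioo, integral_Ioc_eq_integral_Ioo] at hshift
  have hchar : charFun μ t = ∫ u in Set.Ioo 0 1, Complex.exp (t * q u * Complex.I) := by
    rw [charFun_apply_real, ← map_restrict_Ioo_of_rightInvOn_cdf hq hinv,
      integral_map hq.aemeasurable (by fun_prop)]
  simp only [expSum_quantileSample]
  rw [hshift, hchar, Complex.real_smul, Complex.ofReal_natCast]

theorem pow_mul_norm_charFun_pow_le {q : ℝ → ℝ} (hq : Measurable q)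
    (hinv : Set.RightInvOn q (cdf μ) (Set.Ioo 0 1)) {N : ℕ} (hN : N ≠ 0) (m : ℕ) (t : ℝ) :
    (N : ℝ) ^ m * ‖charFun μ t‖ ^ m ≤
      ∫ v in Set.Ioo 0 1, ‖expSum (quantileSample q N v) t‖ ^ m := by
  have : IsProbabilityMeasure (volume.restrict (Set.Ioo (0 : ℝ) 1)) := ⟨by simp⟩
  have hmeas : Measurable fun v => ‖expSum (quantileSample q N v) t‖ :=
    ((measurable_expSum_quantileSample hq N).comp (measurable_id.prodMk measurable_const)).norm
  have hint (j : ℕ) : IntegrableOn (fun v => ‖expSum (quantileSample q N v) t‖ ^ j)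
      (Set.Ioo 0 1) := by
    refine Integrable.of_bound (hmeas.pow_const j).aestronglyMeasurable ((N : ℝ) ^ j)
      (ae_of_all _ fun v => ?_)
    rw [norm_pow, norm_norm]
    exact pow_le_pow_left₀ (norm_nonneg _) (norm_expSum_quantileSample_le q N v t) j
  calc (N : ℝ) ^ m * ‖charFun μ t‖ ^ m
      = ‖∫ v in Set.Ioo 0 1, expSum (quantileSample q N v) t‖ ^ m := by
        rw [integral_expSum_quantileSample hq hinv hN, norm_mul, Complex.norm_natCast, mul_pow]
    _ ≤ (∫ v in Set.Ioo 0 1, ‖expSum (quantileSample q N v) t‖) ^ m :=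
        pow_le_pow_left₀ (norm_nonneg _) (norm_integral_le_integral_norm _) _
    _ ≤ ∫ v in Set.Ioo 0 1, ‖expSum (quantileSample q N v) t‖ ^ m :=
        (convexOn_pow m).map_integral_le (continuousOn_pow _) isClosed_Ici
          (ae_of_all _ fun v => norm_nonneg _) (by simpa only [pow_one] using! hint 1)
          (hint m)

theorem integral_norm_charFun_pow_mul_gaussian_le (hμ : μ ≤ ENNReal.ofReal M • volume) {b : ℝ}
    (hb : 0 < b) (k : ℕ) {N : ℕ} (hN : N ≠ 0) :
    (N : ℝ) ^ (2 * k) * ∫ t, ‖charFun μ t‖ ^ (2 * k) * Real.exp (-b * t ^ 2) ≤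
      (∫ y in (0 : ℝ)..Real.pi, su2Character N y ^ (2 * k)) / Real.pi *
        (2 * √(Real.pi / b) + 2 * Real.pi * (N * M)) := by
  have hM := pos_of_le_ofReal_smul_volume hμ
  obtain ⟨q, hq, hinv⟩ := exists_measurable_rightInvOn_cdf (continuous_cdf hμ)
  set ν : Measure ℝ := volume.restrict (Set.Ioo 0 1)
  have : IsProbabilityMeasure ν := ⟨by simp [ν]⟩
  set F : ℝ → ℝ → ℝ := fun v t =>
    ‖expSum (quantileSample q N v) t‖ ^ (2 * k) * Real.exp (-b * t ^ 2)
  have hF : Integrable (Function.uncurry F) (ν.prod volume) := by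
    refine (((integrable_exp_neg_mul_sq hb).const_mul ((N : ℝ) ^ (2 * k))).comp_snd ν).mono'
      (((measurable_expSum_quantileSample hq N).norm.pow_const _).mul
        (by fun_prop)).aestronglyMeasurable (ae_of_all _ fun p => ?_)
    simp only [Function.uncurry, F]
    rw [Real.norm_of_nonneg (by positivity)]
    gcongr
    exact norm_expSum_quantileSample_le q N p.1 p.2
  have hsample (v : ℝ) (hv : v ∈ Set.Ioo (0 : ℝ) 1) : ∫ t, F v t ≤
      (∫ y in (0 : ℝ)..Real.pi, su2Character N y ^ (2 * k)) / Real.pi *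
        (2 * √(Real.pi / b) + 2 * Real.pi * (N * M)) := by
    have h := integral_norm_expSum_pow_mul_gaussian_le (isSeparated_quantileSample hμ hinv hv N)
      (by positivity) hb k
    rwa [length_quantileSample, one_div, div_inv_eq_mul] at h
  rw [← integral_const_mul]
  calc ∫ t, (N : ℝ) ^ (2 * k) * (‖charFun μ t‖ ^ (2 * k) * Real.exp (-b * t ^ 2))
      ≤ ∫ t, (∫ v, F v t ∂ν) := by
        refine integral_mono_of_nonneg (ae_of_all _ fun t => by positivity)
          hF.integral_prod_right (ae_of_all _ fun t => ?_)
        simp only [F]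
        rw [integral_mul_const, ← mul_assoc]
        exact mul_le_mul_of_nonneg_right (pow_mul_norm_charFun_pow_le hq hinv hN _ t)
          (Real.exp_pos _).le
    _ = ∫ v, (∫ t, F v t) ∂ν := (integral_integral_swap hF).symm
    _ ≤ ∫ _, (∫ y in (0 : ℝ)..Real.pi, su2Character N y ^ (2 * k)) / Real.pi *
          (2 * √(Real.pi / b) + 2 * Real.pi * (N * M)) ∂ν :=
        integral_mono_ae hF.integral_prod_left (integrable_const _)
          ((ae_restrict_mem measurableSet_Ioo).mono hsample)
    _ = _ := by simp

end QuantileSample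

/-- Fatou's lemma along the regularizations `e ^ (-b t²) → 1`. -/
theorem integrable_and_integral_le_of_forall_gaussian {f : ℝ → ℝ} (hf0 : 0 ≤ f) (hf : Measurable f)
    {K : ℝ} (hint : ∀ b > 0, Integrable fun t => f t * Real.exp (-b * t ^ 2))
    (hK : ∀ b > 0, ∫ t, f t * Real.exp (-b * t ^ 2) ≤ K) :
    Integrable f ∧ ∫ t, f t ≤ K := by
  set g : ℕ → ℝ → ℝ := fun n t => f t * Real.exp (-(1 / ((n : ℝ) + 1)) * t ^ 2)
  have hg0 (n : ℕ) : 0 ≤ g n := fun t => mul_nonneg (hf0 t) (Real.exp_pos _).le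
  have hlim (t : ℝ) :
      Tendsto (fun n => ENNReal.ofReal (g n t)) atTop (𝓝 (ENNReal.ofReal (f t))) := by
    have hexponent : Tendsto (fun n : ℕ => -(1 / ((n : ℝ) + 1)) * t ^ 2) atTop (𝓝 (-0 * t ^ 2)) :=
      tendsto_one_div_add_atTop_nhds_zero_nat.neg.mul_const _
    refine ENNReal.tendsto_ofReal ?_
    simpa [g] using ((Real.continuous_exp.tendsto _).comp hexponent).const_mul (f t)
  have hlintegral : ∫⁻ t, ENNReal.ofReal (f t) ≤ ENNReal.ofReal K :=
    calc ∫⁻ t, ENNReal.ofReal (f t)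
        = ∫⁻ t, liminf (fun n => ENNReal.ofReal (g n t)) atTop := by
          simp only [fun t => (hlim t).liminf_eq]
      _ ≤ liminf (fun n => ∫⁻ t, ENNReal.ofReal (g n t)) atTop :=
          lintegral_liminf_le fun n => by fun_prop
      _ ≤ ENNReal.ofReal K := by
          refine liminf_le_of_frequently_le' (Frequently.of_forall fun n => ?_)
          rw [← ofReal_integral_eq_lintegral_ofReal (hint _ (by positivity)) (ae_of_all _ (hg0 n))]
          exact ENNReal.ofReal_le_ofReal (hK _ (by positivity))
  have hKnonneg : 0 ≤ K :=
    (integral_nonneg fun t => mul_nonneg (hf0 t) (Real.exp_pos _).le).trans (hK 1 one_pos)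
  refine ⟨⟨hf.aestronglyMeasurable, ?_⟩, ?_⟩
  · rw [hasFiniteIntegral_iff_ofReal (ae_of_all _ hf0)]
    exact hlintegral.trans_lt ENNReal.ofReal_lt_top
  · rw [integral_eq_lintegral_of_nonneg_ae (ae_of_all _ hf0) hf.aestronglyMeasurable]
    exact ENNReal.toReal_le_of_le_ofReal hKnonneg hlintegral

theorem integrable_and_integral_norm_charFun_pow_le_of_tendsto {μ : Measure ℝ}
    [IsProbabilityMeasure μ] {M : ℝ} (hμ : μ ≤ ENNReal.ofReal M • volume) {k : ℕ} {S : ℝ}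
    (hS : Tendsto (fun N : ℕ => (∫ y in (0 : ℝ)..Real.pi, su2Character N y ^ (2 * k)) * N /
      N ^ (2 * k)) atTop (𝓝 S)) :
    Integrable (fun t => ‖charFun μ t‖ ^ (2 * k)) ∧
      ∫ t, ‖charFun μ t‖ ^ (2 * k) ≤ 2 * M * S := by
  refine integrable_and_integral_le_of_forall_gaussian (fun t => by positivity) (by fun_prop)
    (fun b hb => ?_) fun b hb => ?_
  · refine (integrable_exp_neg_mul_sq hb).mono' (by fun_prop) (ae_of_all _ fun t => ?_)
    rw [Real.norm_of_nonneg (by positivity)]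
    exact mul_le_of_le_one_left (Real.exp_pos _).le
      (pow_le_one₀ (norm_nonneg _) (norm_charFun_le_one t))
  · have hlim := hS.mul ((tendsto_inv_atTop_nhds_zero_nat.const_mul
      (2 * √(Real.pi / b) / Real.pi)).add_const (2 * M))
    rw [show S * (2 * √(Real.pi / b) / Real.pi * 0 + 2 * M) = 2 * M * S by ring] at hlim
    refine ge_of_tendsto hlim ((eventually_ne_atTop 0).mono fun N hN => ?_)
    have h := integral_norm_charFun_pow_mul_gaussian_le hμ hb k hN
    rw [← le_div_iff₀' (by positivity)] at h
    refine h.trans_eq ?_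
    field_simp
section SincIntegrals

theorem su2Character_add_pi (ℓ : ℕ) (x : ℝ) :
    su2Character ℓ (x + Real.pi) = (-1) ^ (ℓ + 1) * su2Character ℓ x := by
  induction ℓ using Nat.twoStepInduction with
  | zero => simp [su2Character_zero]
  | one => simp [su2Character_one]
  | more ℓ ih₀ ih₁ =>
    rw [su2Character_add_two, su2Character_add_two, ih₀, ih₁, Real.cos_add_pi]
    ring

theorem periodic_su2Character_pow (N k : ℕ) :
    Function.Periodic (fun y => su2Character N y ^ (2 * k)) Real.pi := fun y => by
  simp only [su2Character_add_pi, mul_pow, ← pow_mul]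
  rw [(even_two_mul k).mul_left (N + 1) |>.neg_one_pow, one_mul]

theorem su2Character_mul_sinc (N : ℕ) (x : ℝ) :
    su2Character N x * Real.sinc x = N * Real.sinc (N * x) := by
  rcases eq_or_ne x 0 with rfl | hx
  · simp [su2Character, Polynomial.Chebyshev.U_eval_one]
  rcases eq_or_ne N 0 with rfl | hN
  · simp [su2Character_zero]
  · rw [Real.sinc_of_ne_zero hx, Real.sinc_of_ne_zero (by positivity), mul_div_assoc',
      su2Character_mul_sin]
    field_simp

theorem su2Character_div_mul_sinc {N : ℕ} (hN : N ≠ 0) (u : ℝ) :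
    su2Character N (u / N) / N * Real.sinc (u / N) = Real.sinc u := by
  have hN' : (N : ℝ) ≠ 0 := Nat.cast_ne_zero.2 hN
  rw [div_mul_eq_mul_div, su2Character_mul_sinc, mul_div_cancel₀ _ hN', mul_div_cancel_left₀ _ hN']

theorem two_div_pi_le_abs_sinc {x : ℝ} (hx : |x| ≤ Real.pi / 2) : 2 / Real.pi ≤ |Real.sinc x| := by
  rcases eq_or_ne x 0 with rfl | hx0
  · rw [Real.sinc_zero, abs_one, div_le_one Real.pi_pos]
    exact Real.two_le_pi
  · rw [Real.sinc_of_ne_zero hx0, abs_div, le_div_iff₀ (abs_pos.2 hx0)]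
    exact Real.mul_abs_le_abs_sin hx

theorem abs_su2Character_div_le {N : ℕ} (hN : N ≠ 0) {u : ℝ} (hu : |u| ≤ N * (Real.pi / 2)) :
    |su2Character N (u / N) / N| ≤ Real.pi / 2 * |Real.sinc u| := by
  have hN' : (0 : ℝ) < N := by positivity
  have hsinc : 2 / Real.pi ≤ |Real.sinc (u / N)| := two_div_pi_le_abs_sinc <| by
    rwa [abs_div, abs_of_pos hN', div_le_iff₀ hN', mul_comm]
  rw [← su2Character_div_mul_sinc hN u, abs_mul]
  calc |su2Character N (u / N) / N|
      = Real.pi / 2 * (|su2Character N (u / N) / N| * (2 / Real.pi)) := by field_simp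
    _ ≤ _ := by gcongr

theorem tendsto_su2Character_div (u : ℝ) :
    Tendsto (fun N : ℕ => su2Character N (u / N) / N) atTop (𝓝 (Real.sinc u)) := by
  have hsinc : Tendsto (fun N : ℕ => Real.sinc (u / N)) atTop (𝓝 1) := by
    rw [← Real.sinc_zero]
    exact (Real.continuous_sinc.tendsto 0).comp (tendsto_const_div_atTop_nhds_zero_nat u)
  have hquot := (tendsto_const_nhds (x := Real.sinc u)).div hsinc one_ne_zero
  rw [div_one] at hquot
  refine hquot.congr' ?_
  filter_upwards [hsinc.eventually_ne one_ne_zero, eventually_ne_atTop 0] with N hne hN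
  rw [Pi.div_apply, ← su2Character_div_mul_sinc hN u, mul_div_cancel_right₀ _ hne]

theorem integral_su2Character_div_pow {N : ℕ} (hN : N ≠ 0) (k : ℕ) :
    ∫ u in Set.Ioc (-(N * (Real.pi / 2))) (N * (Real.pi / 2)),
        (su2Character N (u / N) / N) ^ (2 * k) =
      (∫ y in (0 : ℝ)..Real.pi, su2Character N y ^ (2 * k)) * N / N ^ (2 * k) := by
  have hN' : (N : ℝ) ≠ 0 := Nat.cast_ne_zero.2 hN
  have hlen : 0 ≤ N * (Real.pi / 2) := by positivity
  have hperiod := (periodic_su2Character_pow N k).intervalIntegral_add_eq (-(Real.pi / 2)) 0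
  rw [show -(Real.pi / 2) + Real.pi = Real.pi / 2 by ring, zero_add] at hperiod
  rw [← intervalIntegral.integral_of_le (by linarith)]
  simp only [div_pow]
  rw [intervalIntegral.integral_div, intervalIntegral.integral_comp_div
    (fun y => su2Character N y ^ (2 * k)) hN', neg_div, mul_div_cancel_left₀ _ hN', hperiod,
    smul_eq_mul, mul_comm]

theorem sinc_sq_le_inv_one_add_sq (u : ℝ) : Real.sinc u ^ 2 ≤ 2 * (1 + u ^ 2)⁻¹ := by
  rw [← div_eq_mul_inv, le_div_iff₀ (by positivity)]
  have hsin : u * Real.sinc u = Real.sin u := by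
    rcases eq_or_ne u 0 with rfl | hu
    · simp
    · rw [Real.sinc_of_ne_zero hu, mul_div_cancel₀ _ hu]
  calc Real.sinc u ^ 2 * (1 + u ^ 2) = Real.sinc u ^ 2 + (u * Real.sinc u) ^ 2 := by ring
    _ ≤ 1 + 1 := by
      rw [hsin]
      exact add_le_add ((sq_le_one_iff_abs_le_one _).2 (Real.abs_sinc_le_one u))
        (Real.sin_sq_le_one u)
    _ = 2 := by norm_num

theorem integrable_sinc_pow {k : ℕ} (hk : 1 ≤ k) :
    Integrable fun u => Real.sinc u ^ (2 * k) := by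
  refine (integrable_inv_one_add_sq.const_mul 2).mono' (by fun_prop) (ae_of_all _ fun u => ?_)
  rw [Real.norm_of_nonneg ((even_two_mul k).pow_nonneg _), pow_mul]
  exact (pow_le_of_le_one (sq_nonneg _)
    ((sq_le_one_iff_abs_le_one _).2 (Real.abs_sinc_le_one u)) (by omega)).trans
    (sinc_sq_le_inv_one_add_sq u)

theorem tendsto_integral_su2Character_pow {k : ℕ} (hk : 1 ≤ k) :
    Tendsto (fun N : ℕ => (∫ y in (0 : ℝ)..Real.pi, su2Character N y ^ (2 * k)) * N /
      N ^ (2 * k)) atTop (𝓝 (∫ u, Real.sinc u ^ (2 * k))) := by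
  set f : ℕ → ℝ → ℝ := fun N => (Set.Ioc (-(N * (Real.pi / 2))) (N * (Real.pi / 2))).indicator
    fun u => (su2Character N (u / N) / N) ^ (2 * k)
  have hbound (N : ℕ) (hN : N ≠ 0) (u : ℝ) :
      ‖f N u‖ ≤ (Real.pi / 2) ^ (2 * k) * Real.sinc u ^ (2 * k) := by
    by_cases hu : u ∈ Set.Ioc (-(N * (Real.pi / 2))) (N * (Real.pi / 2))
    · simp only [f, Set.indicator_of_mem hu]
      rw [norm_pow, Real.norm_eq_abs, ← mul_pow,
        ← (even_two_mul k).pow_abs (_ * _), abs_mul, abs_of_pos Real.pi_div_two_pos]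
      exact pow_le_pow_left₀ (abs_nonneg _)
        (abs_su2Character_div_le hN (abs_le.2 ⟨hu.1.le, hu.2⟩)) _
    · simp only [f, Set.indicator_of_notMem hu, norm_zero]
      exact mul_nonneg (by positivity) ((even_two_mul k).pow_nonneg _)
  have hlim (u : ℝ) : Tendsto (f · u) atTop (𝓝 (Real.sinc u ^ (2 * k))) := by
    refine ((tendsto_su2Character_div u).pow (2 * k)).congr' ?_
    have hlarge : Tendsto (fun N : ℕ => (N : ℝ) * (Real.pi / 2)) atTop atTop :=
      tendsto_natCast_atTop_atTop.atTop_mul_const Real.pi_div_two_pos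
    filter_upwards [hlarge.eventually_gt_atTop |u|] with N hN
    have hmem : u ∈ Set.Ioc (-(N * (Real.pi / 2))) (N * (Real.pi / 2)) :=
      ⟨(abs_lt.1 hN).1, (abs_lt.1 hN).2.le⟩
    simp only [f, Set.indicator_of_mem hmem]
  have hmeas (N : ℕ) : AEStronglyMeasurable (f N) := by
    refine (Measurable.indicator ?_ measurableSet_Ioc).aestronglyMeasurable
    have := (continuous_su2Character N).measurable
    fun_prop
  refine Tendsto.congr' ?_ (tendsto_integral_filter_of_dominated_convergence _
    (Eventually.of_forall hmeas)
    ((eventually_ne_atTop 0).mono fun N hN => ae_of_all _ (hbound N hN))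
    ((integrable_sinc_pow hk).const_mul _) (ae_of_all _ hlim))
  filter_upwards [eventually_ne_atTop 0] with N hN
  rw [integral_indicator measurableSet_Ioc, integral_su2Character_div_pow hN]

theorem su2Character_add_mul (m e : ℕ) (x : ℝ) :
    su2Character (m + 2 * e) x * su2Character m x =
      ∑ r ∈ Finset.range m, su2Character (2 * (r + e) + 1) x := by
  induction m with
  | zero => simp [su2Character_zero]
  | succ m ih =>
    rw [Finset.sum_range_succ, ← ih, show m + 1 + 2 * e = (m + 2 * e) + 1 by ring,
      su2Character_succ_mul_succ, show m + 2 * e + m + 1 = 2 * (m + e) + 1 by ring, add_comm]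

theorem intervalIntegrable_su2Character_mul (m n : ℕ) (a b : ℝ) :
    IntervalIntegrable (fun x => su2Character m x * su2Character n x) volume a b :=
  ((continuous_su2Character m).mul (continuous_su2Character n)).intervalIntegrable _ _

theorem integral_su2Character_mul {m n : ℕ} (hmn : m ≡ n [MOD 2]) :
    ∫ x in (0 : ℝ)..Real.pi, su2Character m x * su2Character n x = Real.pi * (min m n : ℕ) := by
  wlog hnm : n ≤ m generalizing m n
  · simp only [mul_comm (su2Character m _), min_comm m n]
    exact this hmn.symm (by omega)
  obtain ⟨e, rfl⟩ : ∃ e, m = n + 2 * e := ⟨(m - n) / 2, by grind [Nat.ModEq]⟩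
  simp only [su2Character_add_mul]
  rw [intervalIntegral.integral_finsetSum fun r _ =>
      (continuous_su2Character _).intervalIntegrable _ _, min_eq_right hnm]
  simp only [integral_su2Character_odd, Finset.sum_const, Finset.card_range, nsmul_eq_mul]
  rw [mul_comm]

theorem sum_sum_min_odd (N : ℕ) :
    3 * ∑ i ∈ Finset.range N, ∑ j ∈ Finset.range N, min (2 * i + 1) (2 * j + 1) =
      2 * N ^ 3 + N := by
  have hodd (n : ℕ) : ∑ j ∈ Finset.range n, (2 * j + 1) = n ^ 2 := by
    induction n with
    | zero => simp
    | succ n ih => rw [Finset.sum_range_succ, ih]; ring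
  have hmin (n : ℕ) : ∑ j ∈ Finset.range n, min (2 * n + 1) (2 * j + 1) = n ^ 2 := by
    rw [← hodd n]
    exact Finset.sum_congr rfl fun j hj => min_eq_right (by grind)
  induction N with
  | zero => simp
  | succ N ih =>
    simp only [Finset.sum_range_succ _ N, Finset.sum_add_distrib, min_comm _ (2 * N + 1), hmin,
      min_self]
    linear_combination ih

theorem integral_su2Character_pow_four (N : ℕ) :
    ∫ x in (0 : ℝ)..Real.pi, su2Character N x ^ 4 = Real.pi * ((2 * N ^ 3 + N) / 3) := by
  have hexpand (x : ℝ) : su2Character N x ^ 4 = ∑ i ∈ Finset.range N, ∑ j ∈ Finset.range N,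
      su2Character (2 * i + 1) x * su2Character (2 * j + 1) x := by
    have := su2Character_add_mul N 0 x
    simp only [mul_zero, add_zero] at this
    rw [← Finset.sum_mul_sum, ← this]
    ring
  have hsum : ((∑ i ∈ Finset.range N, ∑ j ∈ Finset.range N,
      min (2 * i + 1) (2 * j + 1) : ℕ) : ℝ) = (2 * N ^ 3 + N) / 3 := by
    have : (3 * (∑ i ∈ Finset.range N, ∑ j ∈ Finset.range N,
      min (2 * i + 1) (2 * j + 1) : ℕ) : ℝ) = 2 * N ^ 3 + N := mod_cast sum_sum_min_odd N
    linarith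
  simp only [hexpand, ← Finset.sum_product']
  rw [intervalIntegral.integral_finsetSum fun i _ => intervalIntegrable_su2Character_mul _ _ _ _,
    ← hsum, ← Finset.sum_product', Nat.cast_sum, Finset.mul_sum]
  exact Finset.sum_congr rfl fun i _ => integral_su2Character_mul (by grind [Nat.ModEq])

theorem integral_sinc_sq : ∫ u, Real.sinc u ^ 2 = Real.pi := by
  refine tendsto_nhds_unique (tendsto_integral_su2Character_pow le_rfl)
    (tendsto_const_nhds.congr' ?_)
  filter_upwards [eventually_ne_atTop 0] with N hN
  simp only [mul_one, sq, integral_su2Character_mul rfl, min_self]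
  field_simp

theorem integral_sinc_pow_four : ∫ u, Real.sinc u ^ 4 = 2 * Real.pi / 3 := by
  have hinv : Tendsto (fun N : ℕ => Real.pi * ((2 + ((N : ℝ) ^ 2)⁻¹) / 3)) atTop
      (𝓝 (Real.pi * ((2 + 0) / 3))) :=
    ((((tendsto_pow_atTop two_ne_zero).comp
      tendsto_natCast_atTop_atTop).inv_tendsto_atTop.const_add 2).div_const 3).const_mul _
  rw [show Real.pi * ((2 + 0) / 3) = 2 * Real.pi / 3 by ring] at hinv
  refine tendsto_nhds_unique (tendsto_integral_su2Character_pow one_le_two) (hinv.congr' ?_)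
  filter_upwards [eventually_ne_atTop 0] with N hN
  simp only [Nat.reduceMul, integral_su2Character_pow_four]
  field_simp

/-- The bound comes from Euler's product for the sine and `1 - x ≤ e ^ (-x)` in each factor. -/
theorem sin_le_mul_exp_neg_sq {u : ℝ} (h0 : 0 ≤ u) (hpi : u ≤ Real.pi) :
    Real.sin u ≤ u * Real.exp (-u ^ 2 / 6) := by
  obtain ⟨x, rfl⟩ : ∃ x, u = Real.pi * x := ⟨u / Real.pi, by field_simp⟩
  have hx0 : 0 ≤ x := (mul_nonneg_iff_of_pos_left Real.pi_pos).1 h0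
  have hx1 : x ≤ 1 := (mul_le_iff_le_one_right Real.pi_pos).1 hpi
  have hzeta : HasSum (fun n : ℕ => 1 / ((n : ℝ) + 1) ^ 2) (Real.pi ^ 2 / 6) := by
    simpa using (hasSum_nat_add_iff' 1).2 hasSum_zeta_two
  have hexp : Tendsto (fun n : ℕ => Real.pi * x *
      Real.exp (-x ^ 2 * ∑ j ∈ Finset.range n, 1 / ((j : ℝ) + 1) ^ 2)) atTop
      (𝓝 (Real.pi * x * Real.exp (-x ^ 2 * (Real.pi ^ 2 / 6)))) :=
    ((Real.continuous_exp.tendsto _).comp (hzeta.tendsto_sum_nat.const_mul _)).const_mul _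
  rw [show -(Real.pi * x) ^ 2 / 6 = -x ^ 2 * (Real.pi ^ 2 / 6) by ring]
  refine le_of_tendsto_of_tendsto' (Real.tendsto_euler_sin_prod x) hexp fun n => ?_
  refine mul_le_mul_of_nonneg_left ?_ h0
  rw [Finset.mul_sum, Real.exp_sum]
  refine Finset.prod_le_prod (fun j _ => ?_) fun j _ => ?_
  · have : x ≤ (j : ℝ) + 1 := hx1.trans (by simp)
    rw [sub_nonneg, div_le_one (by positivity)]
    gcongr
  · refine (le_of_eq ?_).trans (Real.add_one_le_exp _)
    ring

theorem sinc_pow_le_exp {u : ℝ} (h0 : 0 < u) (hpi : u ≤ Real.pi) (k : ℕ) :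
    Real.sinc u ^ (2 * k) ≤ Real.exp (-(k / 3) * u ^ 2) := by
  have hnonneg : 0 ≤ Real.sinc u := by
    rw [Real.sinc_of_ne_zero h0.ne']
    exact div_nonneg (Real.sin_nonneg_of_nonneg_of_le_pi h0.le hpi) h0.le
  have hle : Real.sinc u ≤ Real.exp (-u ^ 2 / 6) := by
    rw [Real.sinc_of_ne_zero h0.ne', div_le_iff₀ h0, mul_comm]
    exact sin_le_mul_exp_neg_sq h0.le hpi
  refine (pow_le_pow_left₀ hnonneg hle _).trans_eq ?_
  rw [← Real.exp_nat_mul]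
  congr 1
  push_cast
  ring

theorem sinc_pow_le_rpow {u : ℝ} (h0 : 0 < u) (k : ℕ) :
    Real.sinc u ^ (2 * k) ≤ u ^ (-(2 * k : ℝ)) := by
  rw [Real.sinc_of_ne_zero h0.ne', div_pow, Real.rpow_neg h0.le, ← one_div, pow_mul (Real.sin u)]
  exact_mod_cast div_le_div_of_nonneg_right (pow_le_one₀ (sq_nonneg _) (Real.sin_sq_le_one u))
    (by positivity : 0 ≤ u ^ (2 * k))

theorem integral_sinc_pow_le {k : ℕ} (hk : 1 ≤ k) :
    ∫ u, Real.sinc u ^ (2 * k) ≤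
      √(3 * Real.pi / k) + 2 * (Real.pi ^ (1 - 2 * k : ℝ) / (2 * k - 1)) := by
  have hk' : (1 : ℝ) ≤ k := by exact_mod_cast hk
  have heven : ∫ u, Real.sinc u ^ (2 * k) = 2 * ∫ u in Set.Ioi 0, Real.sinc u ^ (2 * k) := by
    rw [← integral_comp_abs]
    refine integral_congr_ae (ae_of_all _ fun u => ?_)
    rcases abs_choice u with h | h <;> simp only [h, Real.sinc_neg]
  have hint := integrable_sinc_pow hk
  have hhead : ∫ u in Set.Ioc 0 Real.pi, Real.sinc u ^ (2 * k) ≤ √(3 * Real.pi / k) / 2 :=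
    calc ∫ u in Set.Ioc 0 Real.pi, Real.sinc u ^ (2 * k)
        ≤ ∫ u in Set.Ioc 0 Real.pi, Real.exp (-(k / 3) * u ^ 2) :=
          setIntegral_mono_on hint.integrableOn
            (integrable_exp_neg_mul_sq (by positivity)).integrableOn measurableSet_Ioc
            fun u hu => sinc_pow_le_exp hu.1 hu.2 k
      _ ≤ ∫ u in Set.Ioi 0, Real.exp (-(k / 3) * u ^ 2) :=
          setIntegral_mono_set (integrable_exp_neg_mul_sq (by positivity)).integrableOn
            (ae_of_all _ fun u => (Real.exp_pos _).le) Set.Ioc_subset_Ioi_self.eventuallyLE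
      _ = √(3 * Real.pi / k) / 2 := by
          rw [integral_gaussian_Ioi]
          congr 2
          field_simp
  have htail : ∫ u in Set.Ioi Real.pi, Real.sinc u ^ (2 * k) ≤
      Real.pi ^ (1 - 2 * k : ℝ) / (2 * k - 1) :=
    calc ∫ u in Set.Ioi Real.pi, Real.sinc u ^ (2 * k)
        ≤ ∫ u in Set.Ioi Real.pi, u ^ (-(2 * k : ℝ)) :=
          setIntegral_mono_on hint.integrableOn
            (integrableOn_Ioi_rpow_of_lt (by linarith) Real.pi_pos) measurableSet_Ioi
            fun u hu => sinc_pow_le_rpow (Real.pi_pos.trans hu) k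
      _ = Real.pi ^ (1 - 2 * k : ℝ) / (2 * k - 1) := by
          rw [integral_Ioi_rpow_of_lt (by linarith) Real.pi_pos, neg_div, ← div_neg]
          ring_nf
  rw [heven, ← Set.Ioc_union_Ioi_eq_Ioi Real.pi_pos.le, setIntegral_union
    (Set.Ioc_disjoint_Ioi le_rfl) measurableSet_Ioi hint.integrableOn hint.integrableOn]
  linarith

theorem integral_sinc_pow_le_of_three_le {k : ℕ} (hk : 3 ≤ k) :
    ∫ u, Real.sinc u ^ (2 * k) ≤ 0.978 * (Real.pi / √k) := by
  have hk' : (3 : ℝ) ≤ k := by exact_mod_cast hk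
  have hpi := Real.pi_gt_d6
  have hsqrt : 0 < √(k : ℝ) := by positivity
  have hgaussian : √(3 * Real.pi / k) ≤ 0.97721 * (Real.pi / √k) := by
    rw [Real.sqrt_div (by positivity), mul_div_assoc']
    gcongr
    refine Real.sqrt_le_iff.2 ⟨by positivity, ?_⟩
    nlinarith
  have hpow : Real.pi ^ (1 - 2 * k : ℝ) ≤ Real.pi / 961 :=
    calc Real.pi ^ (1 - 2 * k : ℝ) ≤ Real.pi ^ (1 - 6 : ℝ) :=
          Real.rpow_le_rpow_of_exponent_le (by linarith) (by linarith)
      _ = Real.pi / Real.pi ^ 6 := by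
          rw [Real.rpow_sub Real.pi_pos, Real.rpow_one]
          norm_cast
      _ ≤ Real.pi / 961 := by
          refine div_le_div_of_nonneg_left Real.pi_pos.le (by norm_num) ?_
          calc (961 : ℝ) ≤ 3.1415 ^ 6 := by norm_num
            _ ≤ Real.pi ^ 6 := by gcongr; linarith
  have hinv : 1 / (2 * (k : ℝ) - 1) ≤ 0.3465 / √k := by
    rw [div_le_div_iff₀ (by linarith) hsqrt, one_mul]
    refine Real.sqrt_le_iff.2 ⟨by nlinarith, ?_⟩
    nlinarith
  have htail : Real.pi ^ (1 - 2 * k : ℝ) / (2 * k - 1) ≤ 0.3465 / 961 * (Real.pi / √k) :=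
    calc Real.pi ^ (1 - 2 * k : ℝ) / (2 * k - 1)
        = Real.pi ^ (1 - 2 * k : ℝ) * (1 / (2 * k - 1)) := div_eq_mul_one_div _ _
      _ ≤ Real.pi / 961 * (0.3465 / √k) :=
          mul_le_mul hpow hinv (one_div_nonneg.2 (by linarith)) (by positivity)
      _ = 0.3465 / 961 * (Real.pi / √k) := by ring
  have := integral_sinc_pow_le (k := k) (by omega)
  linarith [div_pos Real.pi_pos hsqrt]

theorem integral_sinc_pow_le_pi_div_sqrt {k : ℕ} (hk : 1 ≤ k) :
    ∫ u, Real.sinc u ^ (2 * k) ≤ Real.pi / √k := by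
  rcases (by omega : k = 1 ∨ k = 2 ∨ 3 ≤ k) with rfl | rfl | hk3
  · simp [integral_sinc_sq]
  · have : √(2 : ℝ) ≤ 3 / 2 := Real.sqrt_le_iff.2 (by norm_num)
    simp only [Nat.reduceMul, integral_sinc_pow_four, Nat.cast_ofNat]
    rw [le_div_iff₀ (by positivity)]
    nlinarith [Real.pi_pos]
  · have : 0 < Real.pi / √k := by positivity
    linarith [integral_sinc_pow_le_of_three_le hk3]

end SincIntegrals

section CharFunMoments

variable {μ : Measure ℝ} [IsProbabilityMeasure μ] {M : ℝ}

theorem integrable_norm_charFun_pow (hμ : μ ≤ ENNReal.ofReal M • volume) {k : ℕ} (hk : 1 ≤ k) :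
    Integrable fun t => ‖charFun μ t‖ ^ (2 * k) :=
  (integrable_and_integral_norm_charFun_pow_le_of_tendsto hμ
    (tendsto_integral_su2Character_pow hk)).1

theorem integral_norm_charFun_pow_le_integral_sinc_pow (hμ : μ ≤ ENNReal.ofReal M • volume)
    {k : ℕ} (hk : 1 ≤ k) :
    ∫ t, ‖charFun μ t‖ ^ (2 * k) ≤ 2 * M * ∫ u, Real.sinc u ^ (2 * k) :=
  (integrable_and_integral_norm_charFun_pow_le_of_tendsto hμ
    (tendsto_integral_su2Character_pow hk)).2

end CharFunMoments

section Interpolation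

theorem integral_rpow_mul_rpow_le {α : Type*} [MeasurableSpace α] {μ : Measure α} {f g : α → ℝ}
    (hf : Integrable f μ) (hg : Integrable g μ) (hf0 : 0 ≤ᵐ[μ] f) (hg0 : 0 ≤ᵐ[μ] g) {p q : ℝ}
    (hp : 0 ≤ p) (hq : 0 ≤ q) (hpq : p + q = 1) :
    ∫ a, f a ^ p * g a ^ q ∂μ ≤ (∫ a, f a ∂μ) ^ p * (∫ a, g a ∂μ) ^ q := by
  have hmeas : AEStronglyMeasurable (fun a => f a ^ p * g a ^ q) μ :=
    ((hf.aemeasurable.pow_const p).mul (hg.aemeasurable.pow_const q)).aestronglyMeasurable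
  have hnonneg : 0 ≤ᵐ[μ] fun a => f a ^ p * g a ^ q := by
    filter_upwards [hf0, hg0] with a hfa hga
    exact mul_nonneg (Real.rpow_nonneg hfa p) (Real.rpow_nonneg hga q)
  have hofReal : ∫⁻ a, ENNReal.ofReal (f a ^ p * g a ^ q) ∂μ =
      ∫⁻ a, ENNReal.ofReal (f a) ^ p * ENNReal.ofReal (g a) ^ q ∂μ := by
    refine lintegral_congr_ae ?_
    filter_upwards [hf0, hg0] with a hfa hga
    rw [ENNReal.ofReal_mul (Real.rpow_nonneg hfa p), ENNReal.ofReal_rpow_of_nonneg hfa hp,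
      ENNReal.ofReal_rpow_of_nonneg hga hq]
  rw [integral_eq_lintegral_of_nonneg_ae hnonneg hmeas,
    integral_eq_lintegral_of_nonneg_ae hf0 hf.1, integral_eq_lintegral_of_nonneg_ae hg0 hg.1,
    hofReal, ENNReal.toReal_rpow, ENNReal.toReal_rpow, ← ENNReal.toReal_mul]
  exact ENNReal.toReal_mono
    (ENNReal.mul_ne_top (ENNReal.rpow_ne_top_of_nonneg hp hf.lintegral_lt_top.ne)
      (ENNReal.rpow_ne_top_of_nonneg hq hg.lintegral_lt_top.ne))
    (ENNReal.lintegral_mul_norm_pow_le hf.aemeasurable.ennreal_ofReal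
      hg.aemeasurable.ennreal_ofReal hp hq hpq)

theorem integral_sinc_pow_nonneg (k : ℕ) : 0 ≤ ∫ u, Real.sinc u ^ (2 * k) :=
  integral_nonneg fun _ => (even_two_mul k).pow_nonneg _

theorem sq_integral_sinc_pow_le_of_three_le {k : ℕ} (hk : 3 ≤ k) :
    (∫ u, Real.sinc u ^ (2 * k)) ^ 2 ≤ 0.978 ^ 2 * Real.pi ^ 2 / k := by
  calc (∫ u, Real.sinc u ^ (2 * k)) ^ 2 ≤ (0.978 * (Real.pi / √k)) ^ 2 :=
        pow_le_pow_left₀ (integral_sinc_pow_nonneg k) (integral_sinc_pow_le_of_three_le hk) 2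
    _ = 0.978 ^ 2 * Real.pi ^ 2 / k := by
        rw [mul_pow, div_pow, Real.sq_sqrt k.cast_nonneg, mul_div_assoc]

theorem weighted_mean_sq_integral_sinc_pow_le {k : ℕ} (hk : 2 ≤ k) {θ : ℝ} (h0 : 0 ≤ θ)
    (h1 : θ ≤ 1) :
    (1 - θ) * (∫ u, Real.sinc u ^ (2 * k)) ^ 2 + θ * (∫ u, Real.sinc u ^ (2 * (k + 1))) ^ 2 ≤
      0.98815 ^ 2 * Real.pi ^ 2 / (k + θ) := by
  have hsucc := mul_le_mul_of_nonneg_left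
    (sq_integral_sinc_pow_le_of_three_le (by omega : 3 ≤ k + 1)) h0
  rcases hk.eq_or_lt with rfl | hk3
  · have hnum : (4 / 9 * (1 - θ) + 0.978 ^ 2 / 3 * θ) * (2 + θ) ≤ 0.98815 ^ 2 := by
      nlinarith [sq_nonneg (θ - 0.769)]
    simp only [Nat.reduceMul, Nat.reduceAdd, integral_sinc_pow_four, Nat.cast_ofNat] at hsucc ⊢
    rw [le_div_iff₀ (by positivity)]
    nlinarith [sq_nonneg Real.pi]
  · have hk' : (3 : ℝ) ≤ k := by exact_mod_cast hk3
    have hself := mul_le_mul_of_nonneg_left (sq_integral_sinc_pow_le_of_three_le hk3)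
      (sub_nonneg.2 h1)
    -- The ratio `(k + 1 - θ) (k + θ) / (k (k + 1))` is at most `49 / 48` (`k = 3`, `θ = 1 / 2`).
    have hnum : 0.978 ^ 2 * ((k + 1 - θ) * (k + θ)) ≤ 0.98815 ^ 2 * (k * (k + 1) : ℝ) := by
      nlinarith [sq_nonneg (θ - 1 / 2)]
    calc (1 - θ) * (∫ u, Real.sinc u ^ (2 * k)) ^ 2 + θ * (∫ u, Real.sinc u ^ (2 * (k + 1))) ^ 2
        ≤ (1 - θ) * (0.978 ^ 2 * Real.pi ^ 2 / k) +
            θ * (0.978 ^ 2 * Real.pi ^ 2 / (k + 1 : ℕ)) := add_le_add hself hsucc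
      _ = 0.978 ^ 2 * ((k + 1 - θ) * (k + θ)) * (Real.pi ^ 2 / (k * (k + 1) * (k + θ))) := by
          push_cast
          field_simp
          ring
      _ ≤ 0.98815 ^ 2 * (k * (k + 1)) * (Real.pi ^ 2 / (k * (k + 1) * (k + θ))) := by gcongr
      _ = 0.98815 ^ 2 * Real.pi ^ 2 / (k + θ) := by field_simp

theorem integral_sinc_pow_rpow_mul_rpow_le {k : ℕ} (hk : 2 ≤ k) {θ : ℝ} (h0 : 0 ≤ θ)
    (h1 : θ ≤ 1) :
    (∫ u, Real.sinc u ^ (2 * k)) ^ (1 - θ) * (∫ u, Real.sinc u ^ (2 * (k + 1))) ^ θ ≤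
      0.98815 * (Real.pi / √(k + θ)) := by
  refine le_of_sq_le_sq ?_ (by positivity)
  rw [mul_pow, mul_pow, div_pow, Real.sq_sqrt (by positivity), ← mul_div_assoc,
    Real.rpow_pow_comm (integral_sinc_pow_nonneg k),
    Real.rpow_pow_comm (integral_sinc_pow_nonneg (k + 1))]
  exact (Real.geom_mean_le_arith_mean2_weighted (sub_nonneg.2 h1) h0 (sq_nonneg _) (sq_nonneg _)
    (sub_add_cancel 1 θ)).trans (weighted_mean_sq_integral_sinc_pow_le hk h0 h1)

variable {μ : Measure ℝ} [IsProbabilityMeasure μ] {M : ℝ}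

theorem integrable_norm_charFun_rpow (hμ : μ ≤ ENNReal.ofReal M • volume) {s : ℝ} (hs : 2 ≤ s) :
    Integrable fun t => ‖charFun μ t‖ ^ s := by
  have hmeas : Measurable fun t => ‖charFun μ t‖ ^ s := by fun_prop
  refine (integrable_norm_charFun_pow hμ le_rfl).mono' hmeas.aestronglyMeasurable
    (ae_of_all _ fun t => ?_)
  rw [Real.norm_of_nonneg (by positivity), ← Real.rpow_natCast]
  exact Real.rpow_le_rpow_of_exponent_ge_of_imp (norm_nonneg _) (norm_charFun_le_one t)
    (by exact_mod_cast hs) fun _ hs0 => by linarith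

theorem integral_norm_charFun_rpow_le (hμ : μ ≤ ENNReal.ofReal M • volume) {s : ℝ} (hs : 4 ≤ s) :
    ∫ t, ‖charFun μ t‖ ^ s ≤ 0.98815 * (2 * Real.pi * M * √(2 / s)) := by
  have hM := pos_of_le_ofReal_smul_volume hμ
  obtain ⟨k, θ, hk, h0, h1, rfl⟩ : ∃ (k : ℕ) (θ : ℝ), 2 ≤ k ∧ 0 ≤ θ ∧ θ ≤ 1 ∧ s = 2 * (k + θ) :=
    ⟨⌊s / 2⌋₊, s / 2 - ⌊s / 2⌋₊, Nat.le_floor (by push_cast; linarith),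
      sub_nonneg.2 (Nat.floor_le (by linarith)), by linarith [Nat.lt_floor_add_one (s / 2)],
      by ring⟩
  have hsplit (t : ℝ) : ‖charFun μ t‖ ^ (2 * (k + θ)) =
      (‖charFun μ t‖ ^ (2 * k)) ^ (1 - θ) * (‖charFun μ t‖ ^ (2 * (k + 1))) ^ θ := by
    simp only [← Real.rpow_natCast_mul (norm_nonneg _)]
    rw [← Real.rpow_add_of_nonneg (norm_nonneg _)
      (mul_nonneg (Nat.cast_nonneg _) (sub_nonneg.2 h1)) (by positivity)]
    push_cast
    ring_nf
  have hnonneg (j : ℕ) : 0 ≤ᵐ[volume] fun t => ‖charFun μ t‖ ^ (2 * j) :=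
    ae_of_all _ fun t => by positivity
  have hθ := sub_nonneg.2 h1
  calc ∫ t, ‖charFun μ t‖ ^ (2 * (k + θ))
      ≤ (∫ t, ‖charFun μ t‖ ^ (2 * k)) ^ (1 - θ) * (∫ t, ‖charFun μ t‖ ^ (2 * (k + 1))) ^ θ := by
        simp only [hsplit]
        exact integral_rpow_mul_rpow_le (integrable_norm_charFun_pow hμ (by omega))
          (integrable_norm_charFun_pow hμ (by omega)) (hnonneg k) (hnonneg (k + 1)) hθ h0
          (sub_add_cancel 1 θ)
    _ ≤ (2 * M * ∫ u, Real.sinc u ^ (2 * k)) ^ (1 - θ) *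
          (2 * M * ∫ u, Real.sinc u ^ (2 * (k + 1))) ^ θ := by
        gcongr
        · exact Real.rpow_nonneg (mul_nonneg (by positivity) (integral_sinc_pow_nonneg k)) _
        · exact integral_norm_charFun_pow_le_integral_sinc_pow hμ (by omega)
        · exact integral_norm_charFun_pow_le_integral_sinc_pow hμ (by omega)
    _ = 2 * M * ((∫ u, Real.sinc u ^ (2 * k)) ^ (1 - θ) *
          (∫ u, Real.sinc u ^ (2 * (k + 1))) ^ θ) := by
        rw [Real.mul_rpow (by positivity) (integral_sinc_pow_nonneg k),
          Real.mul_rpow (by positivity) (integral_sinc_pow_nonneg (k + 1)), mul_mul_mul_comm,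
          ← Real.rpow_add (by positivity), sub_add_cancel, Real.rpow_one]
    _ ≤ 2 * M * (0.98815 * (Real.pi / √(k + θ))) :=
        mul_le_mul_of_nonneg_left (integral_sinc_pow_rpow_mul_rpow_le hk h0 h1)
          (by positivity)
    _ = 0.98815 * (2 * Real.pi * M * √(2 / (2 * (k + θ)))) := by
        rw [div_mul_cancel_left₀ two_ne_zero, Real.sqrt_inv]
        ring

end Interpolation

section PointwiseBound

theorem norm_charFun_eq_integral_cos {μ : Measure ℝ} [IsFiniteMeasure μ] (t : ℝ) :
    ‖charFun μ t‖ = ∫ x, Real.cos (t * x - Complex.arg (charFun μ t)) ∂μ := by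
  set φ := Complex.arg (charFun μ t) with hφ
  have hrotate : (‖charFun μ t‖ : ℂ) = charFun μ t * Complex.exp (-(φ * Complex.I)) := by
    nth_rw 2 [← Complex.norm_mul_exp_arg_mul_I (charFun μ t)]
    rw [← hφ, mul_assoc, ← Complex.exp_add, add_neg_cancel, Complex.exp_zero, mul_one]
  have hint : Integrable (fun x : ℝ => Complex.exp ((t * x - φ : ℝ) * Complex.I)) μ :=
    Integrable.of_bound (by fun_prop) 1 (ae_of_all _ fun x => by
      rw [Complex.norm_exp_ofReal_mul_I])
  have hexp : (‖charFun μ t‖ : ℂ) = ∫ x, Complex.exp ((t * x - φ : ℝ) * Complex.I) ∂μ := by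
    rw [hrotate, charFun_apply_real, ← integral_mul_const]
    refine integral_congr_ae (ae_of_all _ fun x => ?_)
    simp only [← Complex.exp_add]
    push_cast
    ring_nf
  calc ‖charFun μ t‖ = (∫ x, Complex.exp ((t * x - φ : ℝ) * Complex.I) ∂μ).re := by
        rw [← hexp, Complex.ofReal_re]
    _ = ∫ x, (Complex.exp ((t * x - φ : ℝ) * Complex.I)).re ∂μ := (integral_re hint).symm
    _ = ∫ x, Real.cos (t * x - φ) ∂μ := by simp only [Complex.exp_ofReal_mul_I_re]

theorem one_sub_variance_div_sq_le_measureReal_Ioc {μ : Measure ℝ} [IsProbabilityMeasure μ]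
    (hL : MemLp id 2 μ) {R : ℝ} (hR : 0 < R) :
    1 - Var[id; μ] / R ^ 2 ≤ μ.real (Set.Ioc (μ[id] - R) (μ[id] + R)) := by
  have hsub : (Set.Ioc (μ[id] - R) (μ[id] + R))ᶜ ⊆ {x | R ≤ |id x - μ[id]|} := by
    intro x hx
    simp only [Set.mem_compl_iff, Set.mem_Ioc, not_and_or, not_lt, not_le] at hx
    exact le_abs'.2 (hx.imp (fun h => sub_le_comm.1 (by linarith))
      fun h => le_sub_iff_add_le'.2 h.le)
  have hcompl : μ.real (Set.Ioc (μ[id] - R) (μ[id] + R))ᶜ ≤ Var[id; μ] / R ^ 2 :=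
    ENNReal.toReal_le_of_le_ofReal (div_nonneg (variance_nonneg _ _) (sq_nonneg R))
      ((measure_mono hsub).trans (meas_ge_le_variance_div_sq hL hR))
  rw [probReal_compl_eq_one_sub measurableSet_Ioc] at hcompl
  linarith

theorem mul_measureReal_sub_le_integral {α : Type*} [MeasurableSpace α] {μ ν : Measure α}
    [IsFiniteMeasure μ] {M : ℝ} (hM : 0 ≤ M) (hμ : μ ≤ ENNReal.ofReal M • ν) {ψ : α → ℝ}
    (hψ : Integrable ψ μ) (hψ0 : 0 ≤ ψ) (s : Set α) (l : ℝ)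
    (hν : IntegrableOn (fun x => max (l - ψ x) 0) s ν) :
    l * μ.real s - M * ∫ x in s, max (l - ψ x) 0 ∂ν ≤ ∫ x, ψ x ∂μ := by
  have hpos : IntegrableOn (fun x => max (l - ψ x) 0) s μ :=
    ((integrable_const l).sub hψ).pos_part.integrableOn
  have hdensity : ∫ x in s, max (l - ψ x) 0 ∂μ ≤ M * ∫ x in s, max (l - ψ x) 0 ∂ν := by
    have hle : μ.restrict s ≤ ENNReal.ofReal M • ν.restrict s := by
      rw [← Measure.restrict_smul]
      exact Measure.restrict_mono_measure hμ s
    have h := integral_mono_measure hle (ae_of_all _ fun x => le_max_right (l - ψ x) 0)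
      (hν.smul_measure ENNReal.ofReal_ne_top)
    rwa [integral_smul_measure, ENNReal.toReal_ofReal hM, smul_eq_mul] at h
  calc l * μ.real s - M * ∫ x in s, max (l - ψ x) 0 ∂ν
      ≤ l * μ.real s - ∫ x in s, max (l - ψ x) 0 ∂μ := by gcongr
    _ = ∫ x in s, (l - max (l - ψ x) 0) ∂μ := by
        rw [integral_sub (integrable_const l) hpos, setIntegral_const, smul_eq_mul, mul_comm]
    _ ≤ ∫ x in s, ψ x ∂μ :=
        integral_mono ((integrable_const l).sub hpos) hψ.integrableOn fun x => by
          linarith [le_max_left (l - ψ x) 0]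
    _ ≤ ∫ x, ψ x ∂μ := setIntegral_le_integral hψ (ae_of_all _ hψ0)

theorem integral_comp_mul_sub_of_periodic {q : ℝ → ℝ}
    (hq : Function.Periodic q (2 * Real.pi))
    (hqc : Continuous q) {u R : ℝ} (hu : u ≠ 0) {j : ℕ} (hRu : R * u = j * Real.pi) (a φ : ℝ) :
    ∫ x in (a - R)..(a + R), q (u * x - φ) =
      R / Real.pi * ∫ y in (-Real.pi)..Real.pi, q y := by
  have hend : u * (a + R) - φ = (u * (a - R) - φ) + (j : ℤ) • (2 * Real.pi) := by
    rw [natCast_zsmul, nsmul_eq_mul]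
    linear_combination 2 * hRu
  have hperiod := hq.intervalIntegral_add_eq (u * (a - R) - φ) (-Real.pi)
  rw [show -Real.pi + 2 * Real.pi = Real.pi by ring] at hperiod
  rw [intervalIntegral.integral_comp_mul_sub q hu, hend, hq.intervalIntegral_add_zsmul_eq _ _
    fun a b => hqc.intervalIntegrable a b, hperiod, natCast_zsmul, nsmul_eq_mul, smul_eq_mul,
    ← mul_assoc, eq_div_of_mul_eq hu hRu]
  field_simp

theorem integral_sq_sub_sq (c : ℝ) : ∫ y in (-c)..c, (c ^ 2 - y ^ 2) = 4 * c ^ 3 / 3 := by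
  rw [intervalIntegral.integral_sub (by simp) (Continuous.intervalIntegrable (by fun_prop) _ _),
    intervalIntegral.integral_const, integral_pow, smul_eq_mul]
  norm_num
  ring

theorem integral_max_sub_one_sub_cos_le {c : ℝ} (hc : 0 ≤ c) :
    ∫ y in (-Real.pi)..Real.pi, max (2 * c ^ 2 / Real.pi ^ 2 - (1 - Real.cos y)) 0 ≤
      8 * c ^ 3 / (3 * Real.pi ^ 2) := by
  have hpi := Real.pi_pos
  set parabola : ℝ → ℝ :=
    (Set.Icc (-c) c).indicator fun y => 2 / Real.pi ^ 2 * (c ^ 2 - y ^ 2) with hparabola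
  have hint : Integrable parabola :=
    (Continuous.integrableOn_Icc (by fun_prop)).integrable_indicator measurableSet_Icc
  have hnonneg (y : ℝ) : 0 ≤ parabola y :=
    Set.indicator_nonneg (fun y hy => mul_nonneg (by positivity)
      (sub_nonneg.2 (sq_le_sq' hy.1 hy.2))) y
  have hle (y : ℝ) (hy : y ∈ Set.Icc (-Real.pi) Real.pi) :
      max (2 * c ^ 2 / Real.pi ^ 2 - (1 - Real.cos y)) 0 ≤ parabola y := by
    have hcos := Real.cos_le_one_sub_mul_cos_sq (abs_le.2 hy)
    refine max_le ?_ (hnonneg y)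
    calc 2 * c ^ 2 / Real.pi ^ 2 - (1 - Real.cos y) ≤ 2 / Real.pi ^ 2 * (c ^ 2 - y ^ 2) := by
          linarith [show 2 * c ^ 2 / Real.pi ^ 2 = 2 / Real.pi ^ 2 * c ^ 2 by ring]
      _ ≤ parabola y := by
          by_cases hm : y ∈ Set.Icc (-c) c
          · rw [hparabola, Set.indicator_of_mem hm]
          · rw [hparabola, Set.indicator_of_notMem hm]
            have habs : c ≤ |y| := le_of_not_ge fun h => hm (abs_le.1 h)
            exact mul_nonpos_of_nonneg_of_nonpos (by positivity)
              (sub_nonpos.2 (sq_le_sq.2 (by rwa [abs_of_nonneg hc])))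
  calc ∫ y in (-Real.pi)..Real.pi, max (2 * c ^ 2 / Real.pi ^ 2 - (1 - Real.cos y)) 0
      ≤ ∫ y in (-Real.pi)..Real.pi, parabola y :=
        intervalIntegral.integral_mono_on (by linarith)
          (Continuous.intervalIntegrable (by fun_prop) _ _) hint.intervalIntegrable hle
    _ ≤ ∫ y, parabola y := by
        rw [intervalIntegral.integral_of_le (by linarith)]
        exact setIntegral_le_integral hint (ae_of_all _ hnonneg)
    _ = ∫ y in (-c)..c, 2 / Real.pi ^ 2 * (c ^ 2 - y ^ 2) := by
        rw [hparabola, integral_indicator measurableSet_Icc, integral_Icc_eq_integral_Ioc,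
          ← intervalIntegral.integral_of_le (by linarith)]
    _ = 8 * c ^ 3 / (3 * Real.pi ^ 2) := by
        rw [intervalIntegral.integral_const_mul, integral_sq_sub_sq]
        field_simp
        norm_num [mul_comm]

variable {μ : Measure ℝ} [IsProbabilityMeasure μ] {M : ℝ}

theorem norm_charFun_le_one_sub (hμ : μ ≤ ENNReal.ofReal M • volume) (hL : MemLp id 2 μ)
    {u R : ℝ} (hu : u ≠ 0) (hR : 0 < R) (hV : Var[id; μ] ≤ R ^ 2) {j : ℕ}
    (hRu : R * u = j * Real.pi) :
    ‖charFun μ u‖ ≤ 1 - (1 - Var[id; μ] / R ^ 2) ^ 3 / (6 * R ^ 2 * M ^ 2) := by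
  have hM := pos_of_le_ofReal_smul_volume hμ
  have hmass := one_sub_variance_div_sq_le_measureReal_Ioc hL hR
  set m := 1 - Var[id; μ] / R ^ 2
  set I := Set.Ioc (μ[id] - R) (μ[id] + R)
  set φ := Complex.arg (charFun μ u)
  have hm0 : 0 ≤ m := sub_nonneg.2 (div_le_one_of_le₀ hV (sq_nonneg R))
  -- `c` maximizes the lower bound `2 c ^ 2 m / π ^ 2 - 8 M R c ^ 3 / (3 π ^ 3)` below.
  set c := Real.pi * m / (2 * R * M) with hc
  set l := 2 * c ^ 2 / Real.pi ^ 2 with hl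
  have hcos : Integrable (fun x => Real.cos (u * x - φ)) μ :=
    Integrable.of_bound (by fun_prop) 1 (ae_of_all _ fun x => Real.abs_cos_le_one _)
  have hvol : ∫ x in I, max (l - (1 - Real.cos (u * x - φ))) 0 ≤
      R / Real.pi * (8 * c ^ 3 / (3 * Real.pi ^ 2)) := by
    rw [← intervalIntegral.integral_of_le (by linarith),
      integral_comp_mul_sub_of_periodic (q := fun y => max (l - (1 - Real.cos y)) 0)
        (fun y => by simp only [Real.cos_add_two_pi]) (by fun_prop) hu hRu]
    exact mul_le_mul_of_nonneg_left (integral_max_sub_one_sub_cos_le (by positivity))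
      (by positivity)
  have hbathtub := mul_measureReal_sub_le_integral hM.le hμ ((integrable_const 1).sub hcos)
    (fun x => sub_nonneg.2 (Real.cos_le_one _)) I l
    ((Continuous.integrableOn_Icc (by fun_prop)).mono_set Set.Ioc_subset_Icc_self)
  have hlower : m ^ 3 / (6 * R ^ 2 * M ^ 2) ≤ ∫ x, (1 - Real.cos (u * x - φ)) ∂μ :=
    calc m ^ 3 / (6 * R ^ 2 * M ^ 2)
        = l * m - M * (R / Real.pi * (8 * c ^ 3 / (3 * Real.pi ^ 2))) := by
          rw [hl, hc]
          field_simp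
          ring
      _ ≤ l * μ.real I - M * ∫ x in I, max (l - (1 - Real.cos (u * x - φ))) 0 := by gcongr
      _ ≤ ∫ x, (1 - Real.cos (u * x - φ)) ∂μ := hbathtub
  rw [integral_sub (integrable_const 1) hcos, ← norm_charFun_eq_integral_cos, integral_const,
    probReal_univ, one_smul] at hlower
  linarith

theorem norm_charFun_le_of_sq_mul_variance_le_one (hμ : μ ≤ ENNReal.ofReal M • volume)
    (hL : MemLp id 2 μ) {u : ℝ} (hu : 0 < u) (huV : u ^ 2 * Var[id; μ] ≤ 1) :
    ‖charFun μ u‖ ≤ 1 - u ^ 2 / (82 * M ^ 2) := by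
  have hM := pos_of_le_ofReal_smul_volume hμ
  have hpi := Real.pi_gt_d6
  have hpi' := Real.pi_lt_d6
  have hratio : Var[id; μ] / (Real.pi / u) ^ 2 ≤ 0.10133 := by
    rw [div_pow, div_div_eq_mul_div, div_le_iff₀ (by positivity)]
    nlinarith
  have hV : Var[id; μ] ≤ (Real.pi / u) ^ 2 := by
    rw [div_le_iff₀ (by positivity)] at hratio
    nlinarith [sq_nonneg (Real.pi / u)]
  refine (norm_charFun_le_one_sub hμ hL hu.ne' (div_pos Real.pi_pos hu) hV (j := 1)
    (by rw [div_mul_cancel₀ _ hu.ne', Nat.cast_one, one_mul])).trans (sub_le_sub_left ?_ 1)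
  calc u ^ 2 / (82 * M ^ 2) ≤ (1 - 0.10133) ^ 3 * (u ^ 2 / (6 * 3.141593 ^ 2 * M ^ 2)) := by
        rw [mul_div_assoc', div_le_div_iff₀ (by positivity) (by positivity)]
        nlinarith [mul_pos (pow_pos hu 2) (pow_pos hM 2)]
    _ ≤ (1 - Var[id; μ] / (Real.pi / u) ^ 2) ^ 3 * (u ^ 2 / (6 * Real.pi ^ 2 * M ^ 2)) := by
        gcongr
        exact pow_nonneg (sub_nonneg.2 (hratio.trans (by norm_num))) 3
    _ = (1 - Var[id; μ] / (Real.pi / u) ^ 2) ^ 3 / (6 * (Real.pi / u) ^ 2 * M ^ 2) := by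
        field_simp

theorem exists_nat_sq_mul_pi_div_mem_Icc {w : ℝ} (hw : 1 ≤ w) :
    ∃ j : ℕ, 0 < j ∧ (j * Real.pi / w) ^ 2 ∈ Set.Icc 2.46 9.87 := by
  have hpi := Real.pi_gt_d4
  have hpi' := Real.pi_lt_d4
  have hj1 : (1 : ℝ) ≤ ⌊w⌋₊ := by exact_mod_cast (Nat.one_le_floor_iff w).2 hw
  have hjw : ⌊w⌋₊ ≤ w := Nat.floor_le (by linarith)
  have hwj : w < ⌊w⌋₊ + 1 := Nat.lt_floor_add_one w
  have hlower : 1.57 ≤ ⌊w⌋₊ * Real.pi / w := by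
    rw [le_div_iff₀ (by linarith)]
    nlinarith
  have hupper : ⌊w⌋₊ * Real.pi / w ≤ 3.1416 := by
    rw [div_le_iff₀ (by linarith)]
    nlinarith
  exact ⟨⌊w⌋₊, Nat.floor_pos.2 hw, by nlinarith, by nlinarith⟩

theorem norm_charFun_le_of_one_le_sq_mul_variance (hμ : μ ≤ ENNReal.ofReal M • volume)
    (hL : MemLp id 2 μ) {u : ℝ} (hu : 0 < u) (huV : 1 ≤ u ^ 2 * Var[id; μ]) :
    ‖charFun μ u‖ ≤ 1 - 1 / (82 * Var[id; μ] * M ^ 2) := by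
  have hM := pos_of_le_ofReal_smul_volume hμ
  set V := Var[id; μ]
  have hV : 0 < V := pos_of_mul_pos_right (zero_lt_one.trans_le huV) (sq_nonneg u)
  set w := u * √V with hw
  have hw2 : w ^ 2 = u ^ 2 * V := by rw [hw, mul_pow, Real.sq_sqrt hV.le]
  have hw1 : 1 ≤ w := by
    rw [← one_le_sq_iff₀ (by positivity), hw2]
    exact huV
  obtain ⟨j, hj, hr_lower, hr_upper⟩ := exists_nat_sq_mul_pi_div_mem_Icc hw1
  set r := (j * Real.pi / w) ^ 2 with hr
  have hR2 : (j * Real.pi / u) ^ 2 = r * V := by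
    rw [hr, div_pow, div_pow, hw2]
    field_simp
  -- `82` is chosen for `r = π ^ 2`, where `6 r ^ 4 / (r - 1) ^ 3` is close to its maximum.
  have hquartic : 6 * r ^ 4 ≤ 82 * (r - 1) ^ 3 := by
    have hs : 0 ≤ r - 2.46 := by linarith
    have ht : 0 ≤ 9.87 - r := by linarith
    linarith [pow_nonneg hs 4, mul_nonneg (pow_nonneg hs 3) ht,
      mul_nonneg (pow_nonneg hs 2) (pow_nonneg ht 2), mul_nonneg hs (pow_nonneg ht 3),
      pow_nonneg ht 4]
  refine (norm_charFun_le_one_sub hμ hL hu.ne' (R := j * Real.pi / u) (by positivity)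
    (by rw [hR2]; exact le_mul_of_one_le_left hV.le (by linarith)) (j := j)
    (div_mul_cancel₀ _ hu.ne')).trans (sub_le_sub_left ?_ 1)
  calc 1 / (82 * V * M ^ 2) ≤ (r - 1) ^ 3 / (6 * r ^ 4 * V * M ^ 2) := by
        rw [div_le_div_iff₀ (by positivity) (by positivity)]
        nlinarith [mul_le_mul_of_nonneg_right hquartic (by positivity : 0 ≤ V * M ^ 2)]
    _ = (1 - V / (j * Real.pi / u) ^ 2) ^ 3 / (6 * (j * Real.pi / u) ^ 2 * M ^ 2) := by
        rw [hR2]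
        field_simp

theorem norm_charFun_le_exp (hμ : μ ≤ ENNReal.ofReal M • volume) (hL : MemLp id 2 μ) {ε : ℝ}
    (hε : 0 < ε) (hεV : ε ^ 2 * Var[id; μ] ≤ 1) {u : ℝ} (hu : ε ≤ |u|) :
    ‖charFun μ u‖ ≤ Real.exp (-(ε ^ 2 / (82 * M ^ 2))) := by
  have hM := pos_of_le_ofReal_smul_volume hμ
  have habs : ‖charFun μ u‖ = ‖charFun μ |u|‖ := by
    rcases abs_choice u with h | h <;> simp only [h, charFun_neg, RCLike.norm_conj]
  have hu0 : 0 < |u| := hε.trans_le hu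
  suffices ‖charFun μ |u|‖ ≤ 1 - ε ^ 2 / (82 * M ^ 2) from
    habs.trans_le (this.trans (Real.one_sub_le_exp_neg _))
  rcases le_total (|u| ^ 2 * Var[id; μ]) 1 with h | h
  · refine (norm_charFun_le_of_sq_mul_variance_le_one hμ hL hu0 h).trans (sub_le_sub_left ?_ 1)
    gcongr
  · have hV : 0 < Var[id; μ] := pos_of_mul_pos_right (zero_lt_one.trans_le h) (sq_nonneg _)
    refine (norm_charFun_le_of_one_le_sq_mul_variance hμ hL hu0 h).trans (sub_le_sub_left ?_ 1)
    rw [div_le_div_iff₀ (by positivity) (by positivity)]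
    nlinarith [mul_le_mul_of_nonneg_right hεV (by positivity : 0 ≤ 82 * M ^ 2)]

end PointwiseBound

section Tail

theorem one_le_mul_exp {b : ℝ} (h1 : 0.45 ≤ b) (h2 : b ≤ 0.9) :
    1 ≤ b * Real.exp (1.5 * (1 - 0.01577 - b)) := by
  have hz : 0 ≤ 1.5 * (1 - 0.01577 - b) := by linarith
  refine le_trans ?_ (mul_le_mul_of_nonneg_left (Real.sum_le_exp_of_nonneg hz 5) (by linarith))
  simp only [Finset.sum_range_succ, Finset.range_zero, Finset.sum_empty, Nat.factorial]
  have hs : 0 ≤ b - 0.45 := by linarith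
  have ht : 0 ≤ 0.9 - b := by linarith
  norm_num
  linarith [pow_nonneg hs 5, mul_nonneg (pow_nonneg hs 4) ht,
    mul_nonneg (pow_nonneg hs 3) (pow_nonneg ht 2), mul_nonneg (pow_nonneg hs 2) (pow_nonneg ht 3),
    mul_nonneg hs (pow_nonneg ht 4), pow_nonneg ht 5]

variable {μ : Measure ℝ} [IsProbabilityMeasure μ] {M : ℝ}

theorem integral_norm_charFun_pow_le (hμ : μ ≤ ENNReal.ofReal M • volume) {k : ℕ} (hk : 1 ≤ k) :
    ∫ t, ‖charFun μ t‖ ^ (2 * k) ≤ 2 * Real.pi * M / √k := by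
  have hM := pos_of_le_ofReal_smul_volume hμ
  calc ∫ t, ‖charFun μ t‖ ^ (2 * k) ≤ 2 * M * ∫ u, Real.sinc u ^ (2 * k) :=
        integral_norm_charFun_pow_le_integral_sinc_pow hμ hk
    _ ≤ 2 * M * (Real.pi / √k) := by
        gcongr
        exact integral_sinc_pow_le_pi_div_sqrt hk
    _ = 2 * Real.pi * M / √k := by ring

theorem setIntegral_norm_charFun_rpow_le_exp_mul (hμ : μ ≤ ENNReal.ofReal M • volume) {S : Set ℝ}
    (hS : MeasurableSet S) {a : ℝ} (hle : ∀ t ∈ S, ‖charFun μ t‖ ≤ Real.exp (-a)) {s : ℝ} {j : ℕ}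
    (hj : 1 ≤ j) (hjs : 2 * j ≤ s) :
    ∫ t in S, ‖charFun μ t‖ ^ s ≤ Real.exp (-((s - 2 * j) * a)) * (2 * Real.pi * M / √j) := by
  have hj' : (1 : ℝ) ≤ j := by exact_mod_cast hj
  have hint := (integrable_norm_charFun_pow hμ hj).const_mul (Real.exp (-((s - 2 * j) * a)))
  have hsplit (t : ℝ) (ht : t ∈ S) : ‖charFun μ t‖ ^ s ≤
      Real.exp (-((s - 2 * j) * a)) * ‖charFun μ t‖ ^ (2 * j) :=
    calc ‖charFun μ t‖ ^ s = ‖charFun μ t‖ ^ (s - 2 * j) * ‖charFun μ t‖ ^ (2 * j) := by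
          rw [← Real.rpow_natCast, ← Real.rpow_add_of_nonneg (norm_nonneg _) (sub_nonneg.2 hjs)
            (by positivity)]
          push_cast
          ring_nf
      _ ≤ Real.exp (-a) ^ (s - 2 * j) * ‖charFun μ t‖ ^ (2 * j) := by
          gcongr
          exact hle t ht
      _ = Real.exp (-((s - 2 * j) * a)) * ‖charFun μ t‖ ^ (2 * j) := by
          rw [← Real.exp_mul]
          ring_nf
  calc ∫ t in S, ‖charFun μ t‖ ^ s
      ≤ ∫ t in S, Real.exp (-((s - 2 * j) * a)) * ‖charFun μ t‖ ^ (2 * j) :=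
        setIntegral_mono_on (integrable_norm_charFun_rpow hμ (by linarith)).integrableOn
          hint.integrableOn hS hsplit
    _ ≤ ∫ t, Real.exp (-((s - 2 * j) * a)) * ‖charFun μ t‖ ^ (2 * j) :=
        setIntegral_le_integral hint (ae_of_all _ fun t => by positivity)
    _ ≤ Real.exp (-((s - 2 * j) * a)) * (2 * Real.pi * M / √j) := by
        rw [integral_const_mul]
        gcongr
        exact integral_norm_charFun_pow_le hμ hj

theorem exp_neg_le_sqrt_mul_exp_neg {b y : ℝ} (h1 : 0.45 ≤ b) (h2 : b ≤ 0.9) (hy : 0.75 ≤ y) :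
    Real.exp (-((1 - b) * y)) ≤ √b * Real.exp (-(0.01577 * y)) := by
  have hsq : 1 ≤ √b * Real.exp ((1 - 0.01577 - b) * y) := by
    rw [← Real.sqrt_sq (Real.exp_pos ((1 - 0.01577 - b) * y)).le, ← Real.sqrt_mul (by linarith),
      Real.one_le_sqrt, ← Real.exp_nat_mul]
    refine (one_le_mul_exp h1 h2).trans ?_
    refine mul_le_mul_of_nonneg_left (Real.exp_le_exp.2 ?_) (by linarith)
    push_cast
    nlinarith
  calc Real.exp (-((1 - b) * y))
      ≤ √b * Real.exp ((1 - 0.01577 - b) * y) * Real.exp (-((1 - b) * y)) :=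
        le_mul_of_one_le_left (Real.exp_pos _).le hsq
    _ = √b * Real.exp (-(0.01577 * y)) := by
        rw [mul_assoc, ← Real.exp_add]
        ring_nf

theorem setIntegral_norm_charFun_rpow_le (hμ : μ ≤ ENNReal.ofReal M • volume) {S : Set ℝ}
    (hS : MeasurableSet S) {a : ℝ} (hle : ∀ t ∈ S, ‖charFun μ t‖ ≤ Real.exp (-a)) {s : ℝ}
    (hs : 4 ≤ s) :
    ∫ t in S, ‖charFun μ t‖ ^ s ≤
      2 * Real.pi * M * √(2 / s) * Real.exp (-(0.01577 * (s * a))) := by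
  have hM := pos_of_le_ofReal_smul_volume hμ
  rcases le_total (s * a) 0.75 with h | h
  · calc ∫ t in S, ‖charFun μ t‖ ^ s ≤ ∫ t, ‖charFun μ t‖ ^ s :=
          setIntegral_le_integral (integrable_norm_charFun_rpow hμ (by linarith))
            (ae_of_all _ fun t => by positivity)
      _ ≤ 0.98815 * (2 * Real.pi * M * √(2 / s)) := integral_norm_charFun_rpow_le hμ hs
      _ ≤ Real.exp (-(0.01577 * (s * a))) * (2 * Real.pi * M * √(2 / s)) := by
          gcongr
          linarith [Real.one_sub_le_exp_neg (0.01577 * (s * a))]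
      _ = 2 * Real.pi * M * √(2 / s) * Real.exp (-(0.01577 * (s * a))) := mul_comm _ _
  · set j := ⌊9 * s / 20⌋₊
    have hj1 : 1 ≤ j := Nat.le_floor (by push_cast; linarith)
    have hj1' : (1 : ℝ) ≤ j := by exact_mod_cast hj1
    have hjs : (j : ℝ) ≤ 9 * s / 20 := Nat.floor_le (by positivity)
    have hsj : 9 * s / 20 < j + 1 := Nat.lt_floor_add_one _
    have hlower : 0.45 ≤ 2 * j / s := by rw [le_div_iff₀ (by linarith)]; linarith
    have hupper : 2 * j / s ≤ 0.9 := by rw [div_le_iff₀ (by linarith)]; linarith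
    calc ∫ t in S, ‖charFun μ t‖ ^ s
        ≤ Real.exp (-((s - 2 * j) * a)) * (2 * Real.pi * M / √j) :=
          setIntegral_norm_charFun_rpow_le_exp_mul hμ hS hle hj1 (by linarith)
      _ = Real.exp (-((1 - 2 * j / s) * (s * a))) * (2 * Real.pi * M / √j) := by
          field_simp
      _ ≤ √(2 * j / s) * Real.exp (-(0.01577 * (s * a))) * (2 * Real.pi * M / √j) := by
          gcongr
          exact exp_neg_le_sqrt_mul_exp_neg hlower hupper h
      _ = 2 * Real.pi * M * √(2 / s) * Real.exp (-(0.01577 * (s * a))) := by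
          rw [mul_div_right_comm, Real.sqrt_mul (by positivity)]
          field_simp

open scoped Pointwise in
theorem setIntegral_norm_charFun_dilation_rpow_le (hμ : μ ≤ ENNReal.ofReal M • volume)
    (hL : MemLp id 2 μ) {ε : ℝ} (hε : 0 < ε) (hεV : ε ^ 2 * Var[id; μ] ≤ 1) {c : ℝ} (hc : 1 ≤ c)
    {s : ℝ} (hs : 4 ≤ s) :
    ∫ t in {t : ℝ | ε ≤ |t|}, ‖charFun μ (c * t)‖ ^ s ≤
      c⁻¹ * (2 * Real.pi * M * √(2 / s) * Real.exp (-(s * ε ^ 2 / (5200 * M ^ 2)))) := by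
  have hM := pos_of_le_ofReal_smul_volume hμ
  have hc0 : 0 < c := by linarith
  have hmeas : MeasurableSet (c • {t : ℝ | ε ≤ |t|}) :=
    (measurableSet_le measurable_const (by fun_prop)).const_smul₀ c
  have hfar : ∀ u ∈ c • {t : ℝ | ε ≤ |t|}, ‖charFun μ u‖ ≤ Real.exp (-(ε ^ 2 / (82 * M ^ 2))) := by
    rintro _ ⟨t, ht, rfl⟩
    refine norm_charFun_le_exp hμ hL hε hεV ?_
    calc ε ≤ |t| := ht
      _ ≤ c * |t| := le_mul_of_one_le_left (abs_nonneg t) hc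
      _ = |c • t| := by rw [smul_eq_mul, abs_mul, abs_of_pos hc0]
  have hexponent : s * ε ^ 2 / (5200 * M ^ 2) ≤ 0.01577 * (s * (ε ^ 2 / (82 * M ^ 2))) := by
    calc s * ε ^ 2 / (5200 * M ^ 2) = 1 / 5200 * (s * ε ^ 2 / M ^ 2) := by field_simp
      _ ≤ 0.01577 / 82 * (s * ε ^ 2 / M ^ 2) :=
          mul_le_mul_of_nonneg_right (by norm_num) (by positivity)
      _ = 0.01577 * (s * (ε ^ 2 / (82 * M ^ 2))) := by field_simp
  calc ∫ t in {t : ℝ | ε ≤ |t|}, ‖charFun μ (c * t)‖ ^ s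
      = c⁻¹ * ∫ u in c • {t : ℝ | ε ≤ |t|}, ‖charFun μ u‖ ^ s := by
        have h := Measure.setIntegral_comp_smul_of_pos volume (fun u => ‖charFun μ u‖ ^ s)
          {t : ℝ | ε ≤ |t|} hc0
        simpa only [Module.finrank_self, pow_one, smul_eq_mul] using h
    _ ≤ c⁻¹ * (2 * Real.pi * M * √(2 / s) *
          Real.exp (-(0.01577 * (s * (ε ^ 2 / (82 * M ^ 2)))))) := by
        gcongr
        exact setIntegral_norm_charFun_rpow_le hμ hmeas hfar hs
    _ ≤ c⁻¹ * (2 * Real.pi * M * √(2 / s) * Real.exp (-(s * ε ^ 2 / (5200 * M ^ 2)))) := by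
        gcongr

end Tail

section NormalizedSum

theorem memLp_two_of_variance_ne_zero {Ω : Type*} [MeasurableSpace Ω] {P : Measure Ω}
    [IsFiniteMeasure P] {X : Ω → ℝ} (hX : AEMeasurable X P) (h : Var[X; P] ≠ 0) :
    MemLp X 2 P := by
  rw [← evariance_lt_top_iff_memLp hX.aestronglyMeasurable, lt_top_iff_ne_top]
  intro htop
  exact h (by rw [variance, htop, ENNReal.toReal_top])

theorem HasDensityBoundedBy.map_le {Ω : Type*} [MeasurableSpace Ω] {P : Measure Ω} {Z : Ω → ℝ}
    {M : ℝ} (h : HasDensityBoundedBy P Z M) : P.map Z ≤ ENNReal.ofReal M • volume := by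
  obtain ⟨p, -, -, hpM, hp⟩ := h
  rw [hp, ← withDensity_const]
  exact withDensity_mono (ae_of_all _ fun x => ENNReal.ofReal_le_ofReal (hpM x))

theorem normalizedSum_eq_inv_sqrt_mul {Ω : Type*} (Xs : ℕ → Ω → ℝ) (n : ℕ) :
    normalizedSum Xs n = fun ω => (√(n : ℝ))⁻¹ * ∑ i ∈ Finset.range n, Xs i ω := by
  ext ω
  rw [normalizedSum, div_eq_inv_mul]

theorem memLp_normalizedSum {Ω : Type*} [MeasurableSpace Ω] {P : Measure Ω} {Xs : ℕ → Ω → ℝ}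
    {p : ENNReal} (hXs : ∀ i, MemLp (Xs i) p P) (n : ℕ) : MemLp (normalizedSum Xs n) p P := by
  rw [normalizedSum_eq_inv_sqrt_mul]
  exact (memLp_finsetSum _ fun i _ => hXs i).const_mul _

variable {Ω Ω' : Type*} [MeasurableSpace Ω] [MeasurableSpace Ω'] {P : Measure Ω}
  {P' : Measure Ω'} {X : Ω → ℝ} {Xs : ℕ → Ω' → ℝ}

theorem variance_normalizedSum (hX : MemLp X 2 P) (hindep : iIndepFun Xs P')
    (hcopy : ∀ i, IdentDistrib (Xs i) X P' P) {n : ℕ} (hn : n ≠ 0) :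
    Var[normalizedSum Xs n; P'] = Var[X; P] := by
  have hfun : normalizedSum Xs n = fun ω => (√(n : ℝ))⁻¹ * (∑ i ∈ Finset.range n, Xs i) ω := by
    simp only [normalizedSum_eq_inv_sqrt_mul, Finset.sum_apply]
  rw [hfun, variance_const_mul, IndepFun.variance_sum (fun i _ => (hcopy i).memLp_iff.2 hX)
    (fun i _ j _ hij => hindep.indepFun hij), Finset.sum_congr rfl fun i _ => (hcopy i).variance_eq,
    Finset.sum_const, Finset.card_range, nsmul_eq_mul, inv_pow, Real.sq_sqrt n.cast_nonneg,
    inv_mul_cancel_left₀ (by exact_mod_cast hn)]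

theorem charFun_map_normalizedSum_sqrt_mul (hindep : iIndepFun Xs P')
    (hcopy : ∀ i, IdentDistrib (Xs i) X P' P) {n : ℕ} (hn : n ≠ 0) (t : ℝ) :
    charFun (P'.map (normalizedSum Xs n)) (√n * t) = charFun (P.map X) t ^ n := by
  rw [normalizedSum_eq_inv_sqrt_mul, charFun_inv_sqrt_mul_sum hindep
    (fun i => (hcopy i).trans (hcopy 0).symm), inv_mul_cancel_left₀ (by positivity),
    (hcopy 0).map_eq]

theorem norm_charFun_map_pow_eq_rpow (hindep : iIndepFun Xs P')
    (hcopy : ∀ i, IdentDistrib (Xs i) X P' P) {n₀ : ℕ} (hn₀ : n₀ ≠ 0) (n : ℕ) (t : ℝ) :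
    ‖charFun (P.map X) t‖ ^ n =
      ‖charFun (P'.map (normalizedSum Xs n₀)) (√n₀ * t)‖ ^ (n / n₀ : ℝ) := by
  rw [charFun_map_normalizedSum_sqrt_mul hindep hcopy hn₀, norm_pow,
    ← Real.rpow_natCast_mul (norm_nonneg _), mul_div_cancel₀ _ (by exact_mod_cast hn₀),
    Real.rpow_natCast]

theorem inv_sqrt_mul_sqrt_two_div {m : ℝ} (hm : 0 < m) (n K : ℝ) :
    (√m)⁻¹ * (2 * Real.pi * K * √(2 / (n / m))) = 4 * Real.pi * K / √(2 * n) := by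
  have hsqrt : √(2 / (n / m)) = √m * (2 / √(2 * n)) := by
    rw [div_div_eq_mul_div, mul_comm, Real.sqrt_div (by positivity), Real.sqrt_mul hm.le,
      Real.sqrt_mul zero_le_two, div_mul_eq_div_div, Real.div_sqrt, mul_div_assoc]
  rw [hsqrt]
  field_simp
  ring

end NormalizedSum

theorem corollary3p3_general {Ω Ω' : Type*} [MeasurableSpace Ω] [MeasurableSpace Ω']
    {P : Measure Ω} {P' : Measure Ω'} {X : Ω → ℝ} (hX : MemLp X 2 P) {Xs : ℕ → Ω' → ℝ}
    (hindep : iIndepFun Xs P') (hcopy : ∀ i, IdentDistrib (Xs i) X P' P) {n₀ : ℕ} (hn₀ : 1 ≤ n₀)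
    {M : ℝ} (hdens : HasDensityBoundedBy P' (normalizedSum Xs n₀) M) {ε : ℝ} (hε : 0 < ε)
    (hεV : ε ^ 2 * Var[X; P] ≤ 1) {n : ℕ} (hn : 4 * n₀ ≤ n) :
    IntegrableOn (fun t : ℝ => ‖charFun (P.map X) t‖ ^ n) {t : ℝ | ε ≤ |t|} ∧
      ∫ t in {t : ℝ | ε ≤ |t|}, ‖charFun (P.map X) t‖ ^ n ≤
        4 * Real.pi * M / √(2 * (n : ℝ)) *
          Real.exp (-((n : ℝ) * ε ^ 2 / (5200 * (n₀ : ℝ) * M ^ 2))) := by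
  have hn₀' : (1 : ℝ) ≤ n₀ := by exact_mod_cast hn₀
  have hs : (4 : ℝ) ≤ n / n₀ := by
    rw [le_div_iff₀ (by linarith)]
    exact_mod_cast hn
  have hZ := memLp_normalizedSum (fun i => (hcopy i).memLp_iff.2 hX) n₀
  have hZm : AEMeasurable (normalizedSum Xs n₀) P' := hZ.aestronglyMeasurable.aemeasurable
  have := hindep.isProbabilityMeasure
  have : IsProbabilityMeasure (P'.map (normalizedSum Xs n₀)) :=
    Measure.isProbabilityMeasure_map hZm
  have hL : MemLp id 2 (P'.map (normalizedSum Xs n₀)) :=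
    (memLp_map_measure_iff (by fun_prop) hZm).2 hZ
  have hVar : Var[id; P'.map (normalizedSum Xs n₀)] = Var[X; P] := by
    rw [variance_map (by fun_prop) hZm, Function.id_comp,
      variance_normalizedSum hX hindep hcopy (by omega)]
  simp only [norm_charFun_map_pow_eq_rpow hindep hcopy (by omega : n₀ ≠ 0) n]
  refine ⟨((integrable_norm_charFun_rpow hdens.map_le (by linarith)).comp_mul_left'
    (by positivity)).integrableOn, ?_⟩
  refine (setIntegral_norm_charFun_dilation_rpow_le hdens.map_le hL hε (hVar ▸ hεV)
    (Real.one_le_sqrt.2 hn₀') hs).trans_eq ?_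
  have hexponent : n / n₀ * ε ^ 2 / (5200 * M ^ 2) = n * ε ^ 2 / (5200 * n₀ * M ^ 2) := by
    field_simp
  rw [← mul_assoc, inv_sqrt_mul_sqrt_two_div (by linarith), hexponent]

theorem corollary3p3 {Ω Ω' : Type*} [MeasurableSpace Ω] [MeasurableSpace Ω']
    (P : Measure Ω) [IsProbabilityMeasure P] (P' : Measure Ω') [IsProbabilityMeasure P']
    (X : Ω → ℝ) (hX : AEMeasurable X P) (hVar : Var[X; P] = 1)
    (Xs : ℕ → Ω' → ℝ) (hindep : iIndepFun Xs P') (hcopy : ∀ i, IdentDistrib (Xs i) X P' P)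
    (n₀ : ℕ) (hn₀ : 1 ≤ n₀) (M : ℝ)
    (hdens : HasDensityBoundedBy P' (normalizedSum Xs n₀) M)
    (ε : ℝ) (hε : 0 < ε) (hε1 : ε ≤ 1) (n : ℕ) (hn : 4 * n₀ ≤ n) :
    IntegrableOn (fun t : ℝ => ‖charFun (P.map X) t‖ ^ n) {t : ℝ | ε ≤ |t|} ∧
      ∫ t in {t : ℝ | ε ≤ |t|}, ‖charFun (P.map X) t‖ ^ n ≤
        4 * Real.pi * M / √(2 * (n : ℝ)) *
          Real.exp (-((n : ℝ) * ε ^ 2 / (5200 * (n₀ : ℝ) * M ^ 2))) := by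
  have hεV : ε ^ 2 * Var[X; P] ≤ 1 := by rw [hVar, mul_one]; exact pow_le_one₀ hε.le hε1
  exact corollary3p3_general (memLp_two_of_variance_ne_zero hX (hVar ▸ one_ne_zero)) hindep hcopy
    hn₀ hdens hε hεV hn
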